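/- Let $r\ge 1$ be an integer. In inverse binomial sampling, independent Bernoulli trials with success probability $p\in(0,1)$ are observed until $r$ successes occur, and the number $N$ of trials has probability function $f_p(n)=\binom{n-1}{r-1}p^r(1-p)^{n-r}$, $n\ge r$. A (possibly randomized) estimator $\hat p$ of $p$ is given by a family $(\Pi_n)_{n\ge r}$ of probability distributions on $(0,\infty)$, where $\Pi_n$ is the conditional distribution of $\hat p$ given $N=n$; it is non-randomized, $\hat p=g(N)$ with $g:\{r,r+1,\dots\}\to(0,\infty)$, if $\Pi_n$ is the point mass at $g(n)$. For a loss function $L:(0,\infty)\to[0,\infty)$ its risk is $$\eta(p)=\mathbb E[L(\hat p/p)]=\sum_{n=r}^\infty f_p(n)\int_0^\infty L(y/p)\,d\Pi_n(y)\in[0,\infty].$$ Assume that $L$ satisfies the following. 1. $L$ is of bounded variation on $[x_1,x_2]$ whenever $0<x_1<x_2$. 2. $L$ has only finitely many discontinuities in $(0,\infty)$. 3. There are real numbers $K,K'<r$ such that $L(x)=\Theta(x^{K})$ as $x\to0$ and $L(x)=\Theta(x^{K'})$ as $x\to\infty$, where $\Theta$ denotes two-sided bounds up to positive constant factors. 4.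 (a) There is $\xi>0$ such that $L$ is non-increasing on $(0,\xi]$ and $\int_\xi^\infty \frac{L(\xi)-L(x)}{x^{r+1}}\,dx>0$. (b) There is $\xi'>0$ such that $L$ is non-decreasing on $(\xi',\infty)$ and one of the following holds: (i) $L(\xi'-)<L(\xi'+)$ (one-sided limits); (ii) for some integer $t\ge1$, $L$ is of class $C^t$ on an open interval containing $\xi'$, $L^{(i)}(\xi')=0$ for $1\le i\le t-1$, and $(-1)^{t-1}L^{(t)}(\xi')>0$. Let $\mathcal F_{\mathrm n}$ be the class of all $g:\{r,r+1,\dots\}\to(0,\infty)$ for which $\Omega=\lim_{n\to\infty}n\,g(n)$ exists, is finite and is non-zero, and define the asymptotic risk of such a $g$ as $$\bar\eta=\int_0^\infty\frac{\nu^{r-1}e^{-\nu}}{(r-1)!}\,L(\Omega/\nu)\,d\nu .$$ Then $\bar\eta$ attains a finite minimum $\eta^*$ over $\mathcal F_{\mathrm n}$, and $\limsup_{p\to0}\eta(p)$ attains a minimum over all (randomized or non-randomized) estimators, and this minimum equals $\eta^*$. -/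

import Mathlib

open Set Filter Topology MeasureTheory Asymptotics
open scoped ENNReal NNReal

namespace InvBinom

/-- Probability function of the number `N` of Bernoulli(`p`) trials needed to get `r` successes,
meant for `1 ≤ r ≤ n` (note that `(n-1)(n-2)⋯(n-r+1)/(r-1)!` is the binomial coefficient). -/
noncomputable def pmfN (r : ℕ) (p : ℝ) (n : ℕ) : ℝ :=
  ((n - 1).choose (r - 1) : ℝ) * p ^ r * (1 - p) ^ (n - r)

/-- A (possibly randomized) estimator: for every `n ≥ r`, the conditional law of the positive
random variable `p̂` given `N = n`. Values of `law` at `n < r` play no role. -/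
structure Estimator (r : ℕ) where
  law : ℕ → Measure ℝ
  isProb : ∀ n, r ≤ n → IsProbabilityMeasure (law n)
  pos : ∀ n, r ≤ n → law n (Iic 0) = 0

/-- The risk `η(p) = E[L(p̂/p)] = ∑_{n ≥ r} f(n) ∫_0^∞ L(y/p) dΠ_n(y)`, a value in `[0, ∞]`. -/
noncomputable def risk (r : ℕ) (L : ℝ → ℝ) (G : Estimator r) (p : ℝ) : ℝ≥0∞ :=
  ∑' k : ℕ, ENNReal.ofReal (pmfN r p (r + k)) *
    ∫⁻ y in Ioi (0 : ℝ), ENNReal.ofReal (L (y / p)) ∂(G.law (r + k))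

/-- `limsup_{p → 0} η(p)`, where `p` tends to `0` through positive values. -/
noncomputable def limsupRisk (r : ℕ) (L : ℝ → ℝ) (G : Estimator r) : ℝ≥0∞ :=
  limsup (fun p : ℝ => risk r L G p) (𝓝[>] (0 : ℝ))

/-- The function `φ(ν) = ν^{r-1} e^{-ν} / (r-1)!`. -/
noncomputable def phi (r : ℕ) (ν : ℝ) : ℝ :=
  ν ^ (r - 1) * Real.exp (-ν) / ((r - 1).factorial : ℝ)

/-- The asymptotic risk `∫_0^∞ φ(ν) L(Ω/ν) dν`. -/
noncomputable def asympRisk (r : ℕ) (L : ℝ → ℝ) (Ω : ℝ) : ℝ≥0∞ :=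
  ∫⁻ ν in Ioi (0 : ℝ), ENNReal.ofReal (phi r ν * L (Ω / ν))

/-- `g` defines a non-randomized estimator of the class `F_n` with parameter `Ω`:
`g` is positive on `{r, r+1, …}` and `n g(n) → Ω`, a finite non-zero limit. -/
def InClassFn (r : ℕ) (g : ℕ → ℝ) (Ω : ℝ) : Prop :=
  (∀ n, r ≤ n → 0 < g n) ∧ Tendsto (fun n : ℕ => (n : ℝ) * g n) atTop (𝓝 Ω) ∧ Ω ≠ 0

/-- `L` is of bounded variation on every compact interval of `(0, ∞)`. -/
def LocBV (L : ℝ → ℝ) : Prop :=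
  ∀ x₁ x₂ : ℝ, 0 < x₁ → x₁ < x₂ → BoundedVariationOn L (Icc x₁ x₂)

/-- `L` has finitely many discontinuities in `(0, ∞)`. -/
def FinDisc (L : ℝ → ℝ) : Prop :=
  {x : ℝ | 0 < x ∧ ¬ ContinuousAt L x}.Finite

/-- `L(x)` is `Θ(x^K)` as `x → 0` and `Θ(x^{K'})` as `x → ∞`, for some real `K, K' < r`. -/
def ThetaBounds (r : ℕ) (L : ℝ → ℝ) : Prop :=
  (∃ K : ℝ, K < r ∧ L =Θ[𝓝[>] (0 : ℝ)] fun x : ℝ => x ^ K) ∧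
  (∃ K' : ℝ, K' < r ∧ L =Θ[atTop] fun x : ℝ => x ^ K')

/-- Behaviour to the left: `L` is non-increasing up to some `ξ > 0` (included), with
`∫_ξ^∞ (L(ξ) - L(x)) / x^{r+1} dx > 0`. -/
def LeftCond (r : ℕ) (L : ℝ → ℝ) : Prop :=
  ∃ ξ : ℝ, 0 < ξ ∧ AntitoneOn L (Ioc 0 ξ) ∧
    0 < ∫ x in Ioi ξ, (L ξ - L x) / x ^ (r + 1)

/-- `L` has an upward jump at `a`: `L(a-) < L(a+)`. -/
def JumpUp (L : ℝ → ℝ) (a : ℝ) : Prop :=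
  ∃ l u : ℝ, Tendsto L (𝓝[<] a) (𝓝 l) ∧ Tendsto L (𝓝[>] a) (𝓝 u) ∧ l < u

/-- For some `t ≥ 1`, `L` is `C^t` on an open interval around `a`, its derivatives of orders
`1, …, t-1` vanish at `a`, and `(-1)^{t-1} L^{(t)}(a) > 0`. -/
def SmoothUp (L : ℝ → ℝ) (a : ℝ) : Prop :=
  ∃ t : ℕ, 1 ≤ t ∧
    (∃ b c : ℝ, 0 ≤ b ∧ b < a ∧ a < c ∧ ContDiffOn ℝ t L (Ioo b c)) ∧
    (∀ i : ℕ, 1 ≤ i → i < t → iteratedDeriv i L a = 0) ∧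
    0 < (-1 : ℝ) ^ (t - 1) * iteratedDeriv t L a

/-- Behaviour to the right: `L` is non-decreasing on `(ξ', ∞)` for some `ξ' > 0` at which it
either jumps upwards or increases smoothly. -/
def RightCond (L : ℝ → ℝ) : Prop :=
  ∃ ξ' : ℝ, 0 < ξ' ∧ MonotoneOn L (Ioi ξ') ∧ (JumpUp L ξ' ∨ SmoothUp L ξ')

end InvBinom

/-!
The risk at `p` compares the law of `N * p` with its limit as `p → 0`, the Gamma law with density
`phi r`. Two facts follow from this comparison.

*Attainment.* For the estimator `Ω / N` the loss is evaluated at `Ω / (N p)`, and its risk is the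
integral of a step function with steps of length `p` which converges to `phi r ν * L (Ω / ν)` at
almost every `ν`. The power bounds on `L` dominate these step functions, so that the risk tends to
`asympRisk r L Ω` (`tendsto_risk_ratioEstimator`).

*Lower bound.* Average the risk of an arbitrary estimator with respect to `dp / p` over a long
interval `(ε, δ)`. For fixed `N = n` and estimate `y`, the integral of the loss over `p` is about
`1 / n` times the asymptotic risk with parameter `n * y`, hence at least `ηstar / n`. The sum over
the relevant `n` is `ηstar * log (δ / ε) + O(1)`, while the total weight is `log (δ / ε)`; hence the
risk cannot stay below a number smaller than `ηstar` (`le_limsupRisk`).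

For the averaging argument the integral over `ν` has to be cut to a compact interval at a small cost
that is uniform in the parameter. This, and the existence of a minimizing `Ω`, both come from the
compactness of `[0, ∞]` and Fatou's lemma (`exists_asympRisk_le`). As the parameter tends to `0` or
to `∞`, Fatou's lemma bounds the risks below by the limit of `L` there, and the conditions on the
behaviour of `L` to the left and to the right ensure that the asymptotic risk takes values
below these limits (`exists_tendsto_zero_asympRisk_lt`, `exists_tendsto_atTop_asympRisk_lt`).
-/

namespace InvBinom

/-! ### The loss as a measurable function -/

/-- The loss function with values in `[0, ∞]`, set to `0` outside `(0, ∞)`. -/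
noncomputable def lossE (L : ℝ → ℝ) : ℝ → ℝ≥0∞ :=
  (Ioi (0 : ℝ)).indicator fun x => ENNReal.ofReal (L x)

theorem lossE_of_pos (L : ℝ → ℝ) {x : ℝ} (hx : 0 < x) : lossE L x = ENNReal.ofReal (L x) :=
  indicator_of_mem (mem_Ioi.2 hx) _

theorem FinDisc.measurable_indicator {L : ℝ → ℝ} (h : FinDisc L) :
    Measurable ((Ioi (0 : ℝ)).indicator L) := by
  classical
  set D : Set ℝ := {x : ℝ | 0 < x ∧ ¬ ContinuousAt L x} with hD
  have hDf : D.Finite := h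
  set U : Set ℝ := Ioi 0 \ D with hU
  have hUm : MeasurableSet U := measurableSet_Ioi.diff hDf.measurableSet
  have hc : ContinuousOn L U := fun x hx => by
    have : ContinuousAt L x := by
      by_contra hcx
      exact hx.2 ⟨hx.1, hcx⟩
    exact this.continuousWithinAt
  have hm : Measurable (U.indicator L) := by
    have := hc.measurable_piecewise (g := 0) continuous_zero.continuousOn hUm
    rwa [piecewise_eq_indicator] at this
  refine hm.measurable_of_countable_ne (hDf.countable.mono ?_)
  intro x hx
  by_contra hxD
  apply hx
  by_cases h0 : 0 < x
  · rw [indicator_of_mem (show x ∈ U from ⟨h0, hxD⟩), indicator_of_mem (show x ∈ Ioi 0 from h0)]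
  · rw [indicator_of_notMem (fun hx' : x ∈ U => h0 hx'.1),
      indicator_of_notMem (fun hx' : x ∈ Ioi 0 => h0 hx')]

theorem FinDisc.measurable_lossE {L : ℝ → ℝ} (h : FinDisc L) : Measurable (lossE L) := by
  have : lossE L = fun x => ENNReal.ofReal ((Ioi (0 : ℝ)).indicator L x) := by
    funext x
    by_cases hx : x ∈ Ioi (0 : ℝ) <;> simp [lossE, hx]
  rw [this]
  exact h.measurable_indicator.ennreal_ofReal

/-- After the change of variable `x = Ω / ν` the loss is still continuous almost everywhere. -/
theorem FinDisc.ae_continuousAt_div {L : ℝ → ℝ} (h : FinDisc L) {Ω : ℝ} (hΩ : 0 < Ω) :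
    ∀ᵐ ν ∂(volume.restrict (Ioi (0 : ℝ))), ContinuousAt L (Ω / ν) := by
  have hfin : ((fun x : ℝ => Ω / x) '' {x : ℝ | 0 < x ∧ ¬ ContinuousAt L x}).Finite :=
    Set.Finite.image _ h
  filter_upwards [ae_restrict_mem measurableSet_Ioi,
    ae_restrict_of_ae (hfin.countable.ae_notMem volume)] with ν hν hn
  by_contra hc
  refine hn ⟨Ω / ν, ⟨div_pos hΩ hν, hc⟩, ?_⟩
  have : ν ≠ 0 := ne_of_gt hν
  field_simp

theorem tendsto_lossE {L : ℝ → ℝ} {ι : Type*} {l : Filter ι} {u : ι → ℝ} {x : ℝ} (hx : 0 < x)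
    (hc : ContinuousAt L x) (hu : Tendsto u l (𝓝 x)) :
    Tendsto (fun i => lossE L (u i)) l (𝓝 (lossE L x)) := by
  rw [lossE_of_pos L hx]
  refine (ENNReal.tendsto_ofReal (hc.tendsto.comp hu)).congr' ?_
  filter_upwards [hu.eventually (lt_mem_nhds hx)] with i hi
  rw [lossE_of_pos L hi, Function.comp_apply]

/-! ### The Gamma weight -/

theorem phi_nonneg (r : ℕ) {ν : ℝ} (hν : 0 ≤ ν) : 0 ≤ phi r ν := by
  unfold phi; positivity

theorem continuous_phi (r : ℕ) : Continuous (phi r) := by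
  unfold phi; fun_prop

theorem integrableOn_pow_mul_exp_neg (k : ℕ) :
    IntegrableOn (fun ν : ℝ => ν ^ k * Real.exp (-ν)) (Ioi 0) := by
  have := Real.GammaIntegral_convergent (s := k + 1) (by positivity)
  refine this.congr_fun (fun ν _ => ?_) measurableSet_Ioi
  simp [mul_comm]

theorem integrableOn_rpow_mul_exp_neg {s : ℝ} (hs : -1 < s) :
    IntegrableOn (fun ν : ℝ => ν ^ s * Real.exp (-ν)) (Ioi 0) := by
  have := Real.GammaIntegral_convergent (s := s + 1) (by linarith)
  refine this.congr_fun (fun ν _ => ?_) measurableSet_Ioi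
  simp [mul_comm]

theorem integrableOn_add_one_pow_mul_exp_neg (k : ℕ) :
    IntegrableOn (fun ν : ℝ => (ν + 1) ^ k * Real.exp (-ν)) (Ioi 0) := by
  have : (fun ν : ℝ => (ν + 1) ^ k * Real.exp (-ν)) =
      fun ν => ∑ i ∈ Finset.range (k + 1), (k.choose i : ℝ) * (ν ^ i * Real.exp (-ν)) := by
    funext ν
    rw [add_pow, Finset.sum_mul]
    refine Finset.sum_congr rfl fun i _ => ?_
    ring
  rw [this]
  exact integrable_finsetSum _ fun i _ => (integrableOn_pow_mul_exp_neg i).const_mul _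

theorem integrableOn_phi (r : ℕ) : IntegrableOn (phi r) (Ioi 0) :=
  (integrableOn_pow_mul_exp_neg (r - 1)).div_const _

theorem integral_phi (r : ℕ) : ∫ ν in Ioi (0 : ℝ), phi r ν = 1 := by
  unfold phi
  rw [integral_div, div_eq_one_iff_eq (by positivity), ← Real.Gamma_nat_eq_factorial,
    Real.Gamma_eq_integral (by positivity)]
  refine setIntegral_congr_fun measurableSet_Ioi fun ν _ => ?_
  rw [add_sub_cancel_right, Real.rpow_natCast, mul_comm]

theorem lintegral_phi (r : ℕ) : ∫⁻ ν in Ioi (0 : ℝ), ENNReal.ofReal (phi r ν) = 1 := by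
  rw [← ofReal_integral_eq_lintegral_ofReal (integrableOn_phi r), integral_phi, ENNReal.ofReal_one]
  filter_upwards [ae_restrict_mem measurableSet_Ioi] with ν hν
  exact phi_nonneg r (le_of_lt hν)

theorem asympRisk_eq (r : ℕ) (L : ℝ → ℝ) {Ω : ℝ} (hΩ : 0 < Ω) :
    asympRisk r L Ω = ∫⁻ ν in Ioi (0 : ℝ), ENNReal.ofReal (phi r ν) * lossE L (Ω / ν) := by
  refine setLIntegral_congr_fun measurableSet_Ioi fun ν hν => ?_
  rw [lossE_of_pos L (div_pos hΩ hν), ENNReal.ofReal_mul (phi_nonneg r (le_of_lt hν))]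

/-! ### Growth of the loss -/

theorem LocBV.bounded {L : ℝ → ℝ} (h : LocBV L) {a b : ℝ} (ha : 0 < a) (hab : a < b) :
    ∃ B : ℝ, 0 ≤ B ∧ ∀ x ∈ Icc a b, L x ≤ B := by
  have hbv := h a b ha hab
  refine ⟨|L a| + (eVariationOn L (Icc a b)).toReal, by positivity, fun x hx => ?_⟩
  have hd := hbv.dist_le hx (left_mem_Icc.2 hab.le)
  rw [Real.dist_eq] at hd
  have := le_abs_self (L x - L a)
  have := le_abs_self (L a)
  linarith

/-- The two power bounds on the loss, made global. The exponent at infinity is enlarged to lie in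
`(r - 1, r)`, which makes `ν ^ (r - 1 - b)` non-increasing but still integrable at `0`; the
exponent at zero is lowered to a non-positive integer. -/
theorem exists_growth_bound {r : ℕ} (hr : 1 ≤ r) {L : ℝ → ℝ} (h1 : LocBV L)
    (h3 : ThetaBounds r L) :
    ∃ (m : ℕ) (b C : ℝ), (r : ℝ) - 1 < b ∧ b < r ∧ 0 ≤ C ∧
      ∀ x : ℝ, 0 < x → L x ≤ C * ((x⁻¹) ^ m + x ^ b) := by
  obtain ⟨⟨K, hK, hK0⟩, K', hK', hKi⟩ := h3
  obtain ⟨C₁, hC₁⟩ := hK0.1.bound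
  obtain ⟨C₂, hC₂⟩ := hKi.1.bound
  obtain ⟨m, hm⟩ := exists_nat_ge (-K)
  obtain ⟨b, hb1, hb2⟩ := exists_between (show max ((r : ℝ) - 1) K' < r from
    max_lt (by linarith) hK')
  have hbr : (r : ℝ) - 1 < b := lt_of_le_of_lt (le_max_left _ _) hb1
  have hbK : K' < b := lt_of_le_of_lt (le_max_right _ _) hb1
  have hr' : (1 : ℝ) ≤ r := by exact_mod_cast hr
  have hb0 : 0 < b := by linarith
  rw [eventually_nhdsWithin_iff, Metric.eventually_nhds_iff] at hC₁
  obtain ⟨ε, hε, hC₁⟩ := hC₁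
  obtain ⟨T, hT⟩ := eventually_atTop.1 hC₂
  set x₁ : ℝ := min (ε / 2) 1
  set x₂ : ℝ := max T 2
  have hx₁ : 0 < x₁ := lt_min (by linarith) one_pos
  have hx₁1 : x₁ ≤ 1 := min_le_right _ _
  have hx₂2 : 2 ≤ x₂ := le_max_right _ _
  obtain ⟨B, hB0, hB⟩ := h1.bounded hx₁ (show x₁ < x₂ by linarith)
  refine ⟨m, b, |C₁| + |C₂| + B, hbr, hb2, by positivity, fun x hx => ?_⟩
  have hA : 0 ≤ (x⁻¹) ^ m := by positivity
  have hA' : 0 ≤ x ^ b := by positivity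
  rcases le_total x x₁ with hxa | hxa
  · have h := hC₁ (y := x) (by
      rw [Real.dist_eq, sub_zero, abs_of_pos hx]
      have : x₁ ≤ ε / 2 := min_le_left _ _
      linarith) hx
    rw [Real.norm_eq_abs, Real.norm_of_nonneg (by positivity)] at h
    have hp : x ^ K ≤ (x⁻¹) ^ m := by
      rw [← Real.rpow_natCast, Real.inv_rpow hx.le, ← Real.rpow_neg hx.le]
      exact Real.rpow_le_rpow_of_exponent_ge hx (hxa.trans hx₁1) (by linarith)
    have hpK : 0 ≤ x ^ K := by positivity
    calc L x ≤ C₁ * x ^ K := (le_abs_self _).trans h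
      _ ≤ |C₁| * (x⁻¹) ^ m := mul_le_mul (le_abs_self _) hp hpK (abs_nonneg _)
      _ ≤ (|C₁| + |C₂| + B) * ((x⁻¹) ^ m + x ^ b) := by
        apply mul_le_mul <;> first | positivity | linarith [abs_nonneg C₂]
  rcases le_total x x₂ with hxb | hxb
  · have h := hB x ⟨hxa, hxb⟩
    have h1' : 1 ≤ (x⁻¹) ^ m + x ^ b := by
      rcases le_total x 1 with h1x | h1x
      · have := one_le_pow₀ (n := m) ((one_le_inv₀ hx).2 h1x)
        linarith
      · have := Real.one_le_rpow h1x hb0.le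
        linarith
    calc L x ≤ B * 1 := by linarith
      _ ≤ (|C₁| + |C₂| + B) * ((x⁻¹) ^ m + x ^ b) := by
        apply mul_le_mul <;> first | positivity | linarith [abs_nonneg C₂, abs_nonneg C₁]
  · have h := hT x (le_trans (le_max_left _ _) hxb)
    rw [Real.norm_eq_abs, Real.norm_of_nonneg (by positivity)] at h
    have hp : x ^ K' ≤ x ^ b :=
      Real.rpow_le_rpow_of_exponent_le (by linarith) hbK.le
    have hpK : 0 ≤ x ^ K' := by positivity
    calc L x ≤ C₂ * x ^ K' := (le_abs_self _).trans h
      _ ≤ |C₂| * x ^ b := mul_le_mul (le_abs_self _) hp hpK (abs_nonneg _)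
      _ ≤ (|C₁| + |C₂| + B) * ((x⁻¹) ^ m + x ^ b) := by
        apply mul_le_mul <;> first | positivity | linarith [abs_nonneg C₁]

/-- The growth bound, multiplied by the power of `ν` in the Gamma weight. -/
theorem exists_pow_mul_loss_le {r : ℕ} (hr : 1 ≤ r) {L : ℝ → ℝ} (h1 : LocBV L)
    (h3 : ThetaBounds r L) {Ω : ℝ} (hΩ : 0 < Ω) :
    ∃ (k : ℕ) (s C : ℝ), -1 < s ∧ s < 0 ∧ 0 ≤ C ∧
      ∀ ν : ℝ, 0 < ν → ν ^ (r - 1) * L (Ω / ν) ≤ C * (ν ^ k + ν ^ s) := by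
  obtain ⟨m, b, C, hb1, hb2, hC, hL⟩ := exists_growth_bound hr h1 h3
  refine ⟨r - 1 + m, r - 1 - b, C * ((Ω⁻¹) ^ m + Ω ^ b), by linarith, by linarith,
    by positivity, fun ν hν => ?_⟩
  have h := hL (Ω / ν) (by positivity)
  have e1 : ν ^ ((r : ℝ) - 1 - b) = ν ^ (r - 1) * ν⁻¹ ^ b := by
    rw [Real.rpow_sub hν, Real.inv_rpow hν.le, div_eq_mul_inv]
    congr 1
    rw [← Real.rpow_natCast, Nat.cast_sub hr, Nat.cast_one]
  have e2 : (Ω / ν)⁻¹ ^ m = (Ω⁻¹) ^ m * ν ^ m := by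
    rw [inv_div, div_eq_mul_inv, mul_pow, mul_comm]
  have e3 : (Ω / ν) ^ b = Ω ^ b * ν⁻¹ ^ b := by
    rw [div_eq_mul_inv, Real.mul_rpow hΩ.le (by positivity)]
  rw [e2, e3] at h
  rw [e1, pow_add]
  have p1 : 0 ≤ ν ^ m := by positivity
  have p2 : 0 ≤ ν⁻¹ ^ b := by positivity
  have p3 : 0 ≤ Ω⁻¹ ^ m := by positivity
  have p4 : 0 ≤ Ω ^ b := by positivity
  calc ν ^ (r - 1) * L (Ω / ν)
      ≤ ν ^ (r - 1) * (C * (Ω⁻¹ ^ m * ν ^ m + Ω ^ b * ν⁻¹ ^ b)) := by gcongr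
    _ = C * ν ^ (r - 1) * (Ω⁻¹ ^ m * ν ^ m + Ω ^ b * ν⁻¹ ^ b) := by ring
    _ ≤ C * ν ^ (r - 1) * ((Ω⁻¹ ^ m + Ω ^ b) * (ν ^ m + ν⁻¹ ^ b)) := by
        gcongr
        nlinarith [mul_nonneg p3 p2, mul_nonneg p4 p1]
    _ = _ := by ring

theorem measurable_indicator_div {L : ℝ → ℝ} (h2 : FinDisc L) (Ω : ℝ) :
    Measurable fun ν : ℝ => (Ioi (0 : ℝ)).indicator L (Ω / ν) :=
  h2.measurable_indicator.comp (measurable_const.div measurable_id)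

theorem exists_phi_mul_loss_le {r : ℕ} (hr : 1 ≤ r) {L : ℝ → ℝ}
    (hL : ∀ x : ℝ, 0 < x → 0 ≤ L x) (h1 : LocBV L) (h3 : ThetaBounds r L) {Ω : ℝ} (hΩ : 0 < Ω) :
    ∃ (k : ℕ) (s C : ℝ), -1 < s ∧ s < 0 ∧ 0 ≤ C ∧
      ∀ ν : ℝ, 0 < ν → phi r ν * L (Ω / ν) ≤ C * (ν ^ k + ν ^ s) * Real.exp (-ν) := by
  obtain ⟨k, s, C, hs1, hs0, hC, hb⟩ := exists_pow_mul_loss_le hr h1 h3 hΩ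
  refine ⟨k, s, C, hs1, hs0, hC, fun ν hν => ?_⟩
  have hl := hL (Ω / ν) (div_pos hΩ hν)
  have hf : (1 : ℝ) ≤ ((r - 1).factorial : ℝ) := by exact_mod_cast Nat.factorial_pos _
  calc phi r ν * L (Ω / ν)
      = (ν ^ (r - 1) * L (Ω / ν)) * Real.exp (-ν) / ((r - 1).factorial : ℝ) := by
        unfold phi; ring
    _ ≤ (ν ^ (r - 1) * L (Ω / ν)) * Real.exp (-ν) := div_le_self (by positivity) hf
    _ ≤ C * (ν ^ k + ν ^ s) * Real.exp (-ν) :=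
        mul_le_mul_of_nonneg_right (hb ν hν) (Real.exp_pos _).le

/-- The integrand of the asymptotic risk is integrable. -/
theorem integrableOn_phi_mul_loss {r : ℕ} (hr : 1 ≤ r) {L : ℝ → ℝ}
    (hL : ∀ x : ℝ, 0 < x → 0 ≤ L x) (h1 : LocBV L) (h2 : FinDisc L) (h3 : ThetaBounds r L)
    {Ω : ℝ} (hΩ : 0 < Ω) : IntegrableOn (fun ν => phi r ν * L (Ω / ν)) (Ioi 0) := by
  obtain ⟨k, s, C, hs1, -, -, hb⟩ := exists_phi_mul_loss_le hr hL h1 h3 hΩ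
  have hint : IntegrableOn
      (fun ν : ℝ => C * (ν ^ k * Real.exp (-ν) + ν ^ s * Real.exp (-ν))) (Ioi 0) :=
    ((integrableOn_pow_mul_exp_neg k).add (integrableOn_rpow_mul_exp_neg hs1)).const_mul C
  refine Integrable.mono' hint ?_ ?_
  · have : AEStronglyMeasurable (fun ν => phi r ν * (Ioi (0 : ℝ)).indicator L (Ω / ν))
        (volume.restrict (Ioi 0)) :=
      ((continuous_phi r).measurable.mul (measurable_indicator_div h2 Ω)).aestronglyMeasurable
    refine this.congr ?_
    filter_upwards [ae_restrict_mem measurableSet_Ioi] with ν hν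
    rw [indicator_of_mem (mem_Ioi.2 (div_pos hΩ hν))]
  · filter_upwards [ae_restrict_mem measurableSet_Ioi] with ν hν
    have hν : 0 < ν := hν
    have hl := hL (Ω / ν) (div_pos hΩ hν)
    rw [Real.norm_of_nonneg (mul_nonneg (phi_nonneg r hν.le) hl)]
    exact (hb ν hν).trans_eq (by ring)

theorem asympRisk_eq_ofReal {r : ℕ} (hr : 1 ≤ r) {L : ℝ → ℝ}
    (hL : ∀ x : ℝ, 0 < x → 0 ≤ L x) (h1 : LocBV L) (h2 : FinDisc L) (h3 : ThetaBounds r L)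
    {Ω : ℝ} (hΩ : 0 < Ω) :
    asympRisk r L Ω = ENNReal.ofReal (∫ ν in Ioi (0 : ℝ), phi r ν * L (Ω / ν)) := by
  rw [ofReal_integral_eq_lintegral_ofReal (integrableOn_phi_mul_loss hr hL h1 h2 h3 hΩ)]
  · rfl
  filter_upwards [ae_restrict_mem measurableSet_Ioi] with ν hν
  exact mul_nonneg (phi_nonneg r (le_of_lt hν)) (hL _ (div_pos hΩ hν))

/-! ### The asymptotic risk near its two ends -/

theorem integrableOn_pow_mul_exp_mul_sub {r : ℕ} (hr : 1 ≤ r) {L : ℝ → ℝ}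
    (hL : ∀ x : ℝ, 0 < x → 0 ≤ L x) (h1 : LocBV L) (h2 : FinDisc L) (h3 : ThetaBounds r L)
    {Ω : ℝ} (hΩ : 0 < Ω) (l : ℝ) :
    IntegrableOn (fun u => u ^ (r - 1) * Real.exp (-(Ω * u)) * (l - L u⁻¹)) (Ioi 0) := by
  have hi : IntegrableOn (fun ν => phi r ν * (l - L (Ω / ν))) (Ioi 0) := by
    simp only [mul_sub]
    exact ((integrableOn_phi r).mul_const l).sub (integrableOn_phi_mul_loss hr hL h1 h2 h3 hΩ)
  have hi2 := (integrableOn_Ioi_comp_mul_left_iff (fun ν => phi r ν * (l - L (Ω / ν))) 0 hΩ).2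
    (by simpa using hi)
  refine IntegrableOn.congr_fun (hi2.const_mul (((r - 1).factorial : ℝ) / Ω ^ (r - 1)))
    (fun u hu => ?_) measurableSet_Ioi
  have hu : 0 < u := hu
  have e : Ω / (Ω * u) = u⁻¹ := by field_simp
  have hf : ((r - 1).factorial : ℝ) ≠ 0 := by positivity
  simp only [phi, e, mul_pow]
  field_simp

/-- The substitution `ν = Ω u` moves the parameter `Ω` out of the argument of the loss. -/
theorem sub_integral_phi_mul_loss {r : ℕ} (hr : 1 ≤ r) {L : ℝ → ℝ}
    (hL : ∀ x : ℝ, 0 < x → 0 ≤ L x) (h1 : LocBV L) (h2 : FinDisc L) (h3 : ThetaBounds r L)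
    {Ω : ℝ} (hΩ : 0 < Ω) (l : ℝ) :
    l - ∫ ν in Ioi (0 : ℝ), phi r ν * L (Ω / ν) =
      Ω ^ r / ((r - 1).factorial : ℝ) *
        ∫ u in Ioi (0 : ℝ), u ^ (r - 1) * Real.exp (-(Ω * u)) * (l - L u⁻¹) := by
  have e0 : l - ∫ ν in Ioi (0 : ℝ), phi r ν * L (Ω / ν) =
      ∫ ν in Ioi (0 : ℝ), phi r ν * (l - L (Ω / ν)) := by
    simp only [mul_sub]
    rw [integral_sub ((integrableOn_phi r).mul_const l)
      (integrableOn_phi_mul_loss hr hL h1 h2 h3 hΩ), integral_mul_const, integral_phi, one_mul]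
  have e1 := integral_comp_mul_left_Ioi' (fun ν => phi r ν * (l - L (Ω / ν))) 0 hΩ
  rw [mul_zero] at e1
  rw [e0, ← e1, smul_eq_mul, ← integral_const_mul, ← integral_const_mul]
  refine setIntegral_congr_fun measurableSet_Ioi fun u hu => ?_
  have hu : 0 < u := hu
  have e : Ω / (Ω * u) = u⁻¹ := by field_simp
  obtain ⟨k, rfl⟩ : ∃ k, r = k + 1 := ⟨r - 1, by omega⟩
  simp only [phi, e, mul_pow, Nat.add_sub_cancel]
  ring

/-- The asymptotic risk is below `l` as soon as the rescaled integral is positive. -/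
theorem asympRisk_lt_ofReal {r : ℕ} (hr : 1 ≤ r) {L : ℝ → ℝ}
    (hL : ∀ x : ℝ, 0 < x → 0 ≤ L x) (h1 : LocBV L) (h2 : FinDisc L) (h3 : ThetaBounds r L)
    {Ω : ℝ} (hΩ : 0 < Ω) {l : ℝ}
    (hpos : 0 < ∫ u in Ioi (0 : ℝ), u ^ (r - 1) * Real.exp (-(Ω * u)) * (l - L u⁻¹)) :
    asympRisk r L Ω < ENNReal.ofReal l := by
  have h := sub_integral_phi_mul_loss hr hL h1 h2 h3 hΩ l
  have h' : 0 < l - ∫ ν in Ioi (0 : ℝ), phi r ν * L (Ω / ν) := by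
    rw [h]; positivity
  rw [asympRisk_eq_ofReal hr hL h1 h2 h3 hΩ, ENNReal.ofReal_lt_ofReal_iff_of_nonneg]
  · linarith
  refine setIntegral_nonneg measurableSet_Ioi fun ν hν => ?_
  exact mul_nonneg (phi_nonneg r (le_of_lt hν)) (hL _ (div_pos hΩ hν))

/-- If the loss stays below `l` on `(0, ξ]` and satisfies the integral condition there, then the
asymptotic risk is below `l` for small `Ω`: dividing `l - asympRisk Ω` by its order `Ω ^ r` leaves
in the limit at least the integral of the condition. -/
theorem exists_asympRisk_lt_of_le_near_zero {r : ℕ} (hr : 1 ≤ r) {L : ℝ → ℝ}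
    (hL : ∀ x : ℝ, 0 < x → 0 ≤ L x) (h1 : LocBV L) (h2 : FinDisc L) (h3 : ThetaBounds r L)
    {ξ l : ℝ} (hξ : 0 < ξ) (hle : ∀ x ∈ Ioc 0 ξ, L x ≤ l)
    (hint : 0 < ∫ x in Ioi ξ, (L ξ - L x) / x ^ (r + 1)) :
    ∃ Ω : ℝ, 0 < Ω ∧ asympRisk r L Ω < ENNReal.ofReal l := by
  -- the integrand of the condition after the substitution `x = u⁻¹`
  set J : ℝ → ℝ := (Iio ξ⁻¹).indicator fun u => u ^ (r - 1) * (L ξ - L u⁻¹) with hJ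
  have hJpos : 0 < ∫ u in Ioi (0 : ℝ), J u := by
    have e : ∫ x in Ioi ξ, (L ξ - L x) / x ^ (r + 1) = ∫ u in Ioi (0 : ℝ), J u := by
      have e1 : ∫ x in Ioi ξ, (L ξ - L x) / x ^ (r + 1) =
          ∫ x in Ioi (0 : ℝ), (Ioi ξ).indicator (fun x => (L ξ - L x) / x ^ (r + 1)) x := by
        rw [setIntegral_indicator measurableSet_Ioi,
          inter_eq_self_of_subset_right (Ioi_subset_Ioi hξ.le)]
      rw [e1, ← integral_comp_rpow_Ioi _ (show (-1 : ℝ) ≠ 0 by norm_num)]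
      refine setIntegral_congr_fun measurableSet_Ioi fun u hu => ?_
      have hu : 0 < u := hu
      have hiff : u⁻¹ ∈ Ioi ξ ↔ u ∈ Iio ξ⁻¹ := by
        rw [mem_Ioi, mem_Iio, lt_inv_comm₀ hξ hu]
      simp only [hJ, Real.rpow_neg_one]
      by_cases hm : u ∈ Iio ξ⁻¹
      · rw [indicator_of_mem hm, indicator_of_mem (hiff.2 hm)]
        have e2 : u ^ ((-1 : ℝ) - 1) = (u ^ 2)⁻¹ := by
          rw [show (-1 : ℝ) - 1 = -((2 : ℕ) : ℝ) by norm_num, Real.rpow_neg hu.le,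
            Real.rpow_natCast]
        obtain ⟨k, rfl⟩ : ∃ k, r = k + 1 := ⟨r - 1, by omega⟩
        rw [e2, abs_neg, abs_one, one_mul, smul_eq_mul, Nat.add_sub_cancel, inv_pow,
          div_inv_eq_mul]
        field_simp
        ring
      · rw [indicator_of_notMem hm, indicator_of_notMem (mt hiff.1 hm), smul_zero]
    rwa [e] at hint
  -- a non-integrable function would have integral `0`
  have hJint : IntegrableOn J (Ioi 0) := by
    by_contra hn
    rw [integral_undef hn] at hJpos
    exact lt_irrefl _ hJpos
  have hdom : ∀ Ω : ℝ, 0 < Ω → ∀ u ∈ Ioi (0 : ℝ), ‖Real.exp (-(Ω * u)) * J u‖ ≤ ‖J u‖ := by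
    intro Ω hΩ u hu
    have hu : 0 < u := hu
    rw [norm_mul, Real.norm_of_nonneg (Real.exp_pos _).le]
    refine mul_le_of_le_one_left (norm_nonneg _) ?_
    rw [Real.exp_le_one_iff]
    have := mul_pos hΩ hu
    linarith
  have hmeas : ∀ Ω : ℝ, AEStronglyMeasurable (fun u => Real.exp (-(Ω * u)) * J u)
      (volume.restrict (Ioi 0)) := fun Ω =>
    (Continuous.aestronglyMeasurable (by fun_prop)).mul hJint.aestronglyMeasurable
  have hlim : Tendsto (fun Ω : ℝ => ∫ u in Ioi (0 : ℝ), Real.exp (-(Ω * u)) * J u) (𝓝[>] 0)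
      (𝓝 (∫ u in Ioi (0 : ℝ), J u)) := by
    refine tendsto_integral_filter_of_dominated_convergence (fun u => ‖J u‖)
      (Eventually.of_forall hmeas) ?_ hJint.norm ?_
    · filter_upwards [self_mem_nhdsWithin] with Ω hΩ
      filter_upwards [ae_restrict_mem measurableSet_Ioi] with u hu using hdom Ω hΩ u hu
    · refine Eventually.of_forall fun u => ?_
      have hc : Continuous fun Ω : ℝ => Real.exp (-(Ω * u)) * J u := by fun_prop
      have := hc.tendsto 0
      simp only [zero_mul, neg_zero, Real.exp_zero, one_mul] at this
      exact this.mono_left nhdsWithin_le_nhds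
  obtain ⟨Ω, hΩpos, hΩ⟩ := ((hlim.eventually (lt_mem_nhds hJpos)).and self_mem_nhdsWithin).exists
  refine ⟨Ω, hΩ, asympRisk_lt_ofReal hr hL h1 h2 h3 hΩ (hΩpos.trans_le ?_)⟩
  refine setIntegral_mono_on ?_ (integrableOn_pow_mul_exp_mul_sub hr hL h1 h2 h3 hΩ l)
    measurableSet_Ioi fun u hu => ?_
  · refine Integrable.mono hJint (hmeas Ω) ?_
    filter_upwards [ae_restrict_mem measurableSet_Ioi] with u hu using hdom Ω hΩ u hu
  · have hu : 0 < u := hu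
    have hw : 0 ≤ u ^ (r - 1) * Real.exp (-(Ω * u)) := by positivity
    by_cases hm : u ∈ Iio ξ⁻¹
    · rw [hJ, indicator_of_mem hm]
      have := hle ξ ⟨hξ, le_rfl⟩
      calc Real.exp (-(Ω * u)) * (u ^ (r - 1) * (L ξ - L u⁻¹))
          = u ^ (r - 1) * Real.exp (-(Ω * u)) * (L ξ - L u⁻¹) := by ring
        _ ≤ _ := mul_le_mul_of_nonneg_left (by linarith) hw
    · rw [hJ, indicator_of_notMem hm, mul_zero]
      rw [mem_Iio, not_lt, inv_le_comm₀ hξ hu] at hm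
      have := hle u⁻¹ ⟨by positivity, hm⟩
      exact mul_nonneg hw (by linarith)

/-- If the loss is at most `l` on `(c, ∞)`, except possibly at the single point `d` (the place of a
jump), and at most `l - ε` on `(c, d)`, then the asymptotic risk is below `l` for large `Ω`: the
weight `exp (-Ω / x)` makes the gain on `(c, d)` outweigh anything that happens on `(0, c)`. -/
theorem exists_asympRisk_lt_of_le_near_top {r : ℕ} (hr : 1 ≤ r) {L : ℝ → ℝ}
    (hL : ∀ x : ℝ, 0 < x → 0 ≤ L x) (h1 : LocBV L) (h2 : FinDisc L) (h3 : ThetaBounds r L)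
    {c d ε l : ℝ} (hc : 0 < c) (hcd : c < d) (hε : 0 < ε)
    (hle : ∀ x, c < x → x ≠ d → L x ≤ l) (hlt : ∀ x ∈ Ioo c d, L x ≤ l - ε) :
    ∃ Ω : ℝ, 0 < Ω ∧ asympRisk r L Ω < ENNReal.ofReal l := by
  have hd : 0 < d := hc.trans hcd
  have hκ : d⁻¹ < c⁻¹ := inv_strictAnti₀ hc hcd
  have hd' : 0 < d⁻¹ := inv_pos.2 hd
  set W : ℝ → ℝ → ℝ := fun Ω u => u ^ (r - 1) * Real.exp (-(Ω * u)) * (l - L u⁻¹) with hW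
  have hWint : ∀ Ω : ℝ, 0 < Ω → IntegrableOn (W Ω) (Ioi 0) := fun Ω hΩ =>
    integrableOn_pow_mul_exp_mul_sub hr hL h1 h2 h3 hΩ l
  -- After multiplication by `exp (Ω / c)` the integrand is at least `A - B Ω`: `A` is a fixed gain
  -- on `u ∈ (1 / d, 1 / c)`, and `B Ω` is the part `u > 1 / c`, which decays as `Ω → ∞`.
  set A : ℝ → ℝ := (Ioo d⁻¹ c⁻¹).indicator fun _ => ε * d⁻¹ ^ (r - 1) with hA
  set B : ℝ → ℝ → ℝ := fun Ω => (Ioi c⁻¹).indicator fun u => |Real.exp (Ω * c⁻¹) * W Ω u| with hB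
  have hAint : IntegrableOn A (Ioi 0) :=
    ((integrable_indicator_iff measurableSet_Ioo).2
      (integrableOn_const measure_Ioo_lt_top.ne)).integrableOn
  have hApos : 0 < ∫ u in Ioi (0 : ℝ), A u := by
    have hsub : Ioo d⁻¹ c⁻¹ ⊆ Ioi 0 := fun u hu => hd'.trans hu.1
    rw [hA, setIntegral_indicator measurableSet_Ioo, inter_eq_self_of_subset_right hsub,
      setIntegral_const, smul_eq_mul]
    have : 0 < volume.real (Ioo d⁻¹ c⁻¹) := by
      rw [Real.volume_real_Ioo_of_le hκ.le]; linarith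
    positivity
  have hBint : ∀ Ω : ℝ, 0 < Ω → IntegrableOn (B Ω) (Ioi 0) := fun Ω hΩ =>
    (((hWint Ω hΩ).const_mul (Real.exp (Ω * c⁻¹))).abs).indicator measurableSet_Ioi
  have hexp : ∀ Ω u : ℝ, Real.exp (Ω * c⁻¹) * W Ω u =
      u ^ (r - 1) * Real.exp (-(Ω * (u - c⁻¹))) * (l - L u⁻¹) := by
    intro Ω u
    have : Real.exp (-(Ω * (u - c⁻¹))) = Real.exp (Ω * c⁻¹) * Real.exp (-(Ω * u)) := by
      rw [← Real.exp_add]; congr 1; ring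
    rw [this]; simp only [hW]; ring
  have hlim : Tendsto (fun Ω : ℝ => ∫ u in Ioi (0 : ℝ), B Ω u) atTop (𝓝 0) := by
    have h0 : Tendsto (fun Ω : ℝ => ∫ u in Ioi (0 : ℝ), B Ω u) atTop
        (𝓝 (∫ _ in Ioi (0 : ℝ), (0 : ℝ))) := by
      refine tendsto_integral_filter_of_dominated_convergence (B 1) ?_ ?_ (hBint 1 one_pos) ?_
      · filter_upwards [eventually_gt_atTop 0] with Ω hΩ using (hBint Ω hΩ).aestronglyMeasurable
      · filter_upwards [eventually_ge_atTop 1] with Ω hΩ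
        refine Eventually.of_forall fun u => ?_
        by_cases hu : u ∈ Ioi c⁻¹
        · simp only [hB, indicator_of_mem hu, hexp, norm_abs_eq_norm, Real.norm_eq_abs]
          rw [abs_mul, abs_mul, abs_mul, abs_mul, Real.abs_exp, Real.abs_exp]
          have : 0 < u - c⁻¹ := sub_pos.2 hu
          gcongr
        · simp [hB, indicator_of_notMem hu]
      · refine Eventually.of_forall fun u => ?_
        by_cases hu : u ∈ Ioi c⁻¹
        · simp only [hB, indicator_of_mem hu, hexp]
          have hu' : 0 < u - c⁻¹ := sub_pos.2 hu
          have ht : Tendsto (fun Ω : ℝ => Real.exp (-(Ω * (u - c⁻¹)))) atTop (𝓝 0) :=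
            Real.tendsto_exp_neg_atTop_nhds_zero.comp (tendsto_id.atTop_mul_const hu')
          simpa using ((ht.const_mul (u ^ (r - 1))).mul_const (l - L u⁻¹)).abs
        · simp [hB, indicator_of_notMem hu]
    simpa using h0
  obtain ⟨Ω, hΩ1, hΩ⟩ := ((hlim.eventually (gt_mem_nhds hApos)).and (eventually_gt_atTop 0)).exists
  refine ⟨Ω, hΩ, asympRisk_lt_ofReal hr hL h1 h2 h3 hΩ ?_⟩
  have hkey : (∫ u in Ioi (0 : ℝ), A u) - ∫ u in Ioi (0 : ℝ), B Ω u ≤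
      Real.exp (Ω * c⁻¹) * ∫ u in Ioi (0 : ℝ), W Ω u := by
    rw [← integral_sub hAint (hBint Ω hΩ), ← integral_const_mul]
    refine integral_mono_ae (hAint.sub (hBint Ω hΩ)) ((hWint Ω hΩ).const_mul _) ?_
    filter_upwards [ae_restrict_mem measurableSet_Ioi,
      ae_restrict_of_ae (Measure.ae_ne volume c⁻¹),
      ae_restrict_of_ae (Measure.ae_ne volume d⁻¹)] with u hu huc hud
    have hu : 0 < u := hu
    rcases lt_or_gt_of_ne huc with hlt' | hgt
    · have hcu : c < u⁻¹ := (lt_inv_comm₀ hc hu).2 hlt'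
      have hBu : B Ω u = 0 := indicator_of_notMem (fun h => lt_asymm hlt' h) _
      rw [hBu, sub_zero, hexp]
      by_cases hud' : d⁻¹ < u
      · rw [hA, indicator_of_mem (show u ∈ Ioo d⁻¹ c⁻¹ from ⟨hud', hlt'⟩)]
        have h1u := hlt u⁻¹ ⟨hcu, (inv_lt_comm₀ hd hu).1 hud'⟩
        have hE : 1 ≤ Real.exp (-(Ω * (u - c⁻¹))) := by
          apply Real.one_le_exp
          nlinarith
        calc ε * d⁻¹ ^ (r - 1) = d⁻¹ ^ (r - 1) * 1 * ε := by ring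
          _ ≤ _ := by gcongr; linarith
      · rw [hA, indicator_of_notMem (fun h => hud' h.1)]
        have := hle u⁻¹ hcu (fun h => hud (by rw [← h, inv_inv]))
        exact mul_nonneg (by positivity) (by linarith)
    · have hAu : A u = 0 := indicator_of_notMem (fun h => lt_asymm hgt h.2) _
      have hBu : B Ω u = |Real.exp (Ω * c⁻¹) * W Ω u| := indicator_of_mem (mem_Ioi.2 hgt) _
      rw [hAu, hBu, zero_sub]
      exact neg_abs_le _
  have : 0 < Real.exp (Ω * c⁻¹) * ∫ u in Ioi (0 : ℝ), W Ω u := by linarith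
  exact pos_of_mul_pos_right this (Real.exp_pos _).le

/-! ### Limits of the loss at zero and at infinity -/

theorem exists_tendsto_nhdsGT_zero_of_antitoneOn {f : ℝ → ℝ≥0∞} {ξ : ℝ} (hξ : 0 < ξ)
    (hf : AntitoneOn f (Ioc 0 ξ)) :
    ∃ l : ℝ≥0∞, Tendsto f (𝓝[>] 0) (𝓝 l) ∧ ∀ x ∈ Ioc 0 ξ, f x ≤ l := by
  have hle : ∀ x ∈ Ioc 0 ξ, f x ≤ ⨆ y ∈ Ioc 0 ξ, f y := fun x hx =>
    le_iSup₂ (f := fun y _ => f y) x hx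
  refine ⟨⨆ x ∈ Ioc 0 ξ, f x, tendsto_order.2 ⟨fun a ha => ?_, fun a ha => ?_⟩, hle⟩
  · obtain ⟨x, hx, hax⟩ := lt_biSup_iff.1 ha
    filter_upwards [Ioo_mem_nhdsGT hx.1] with y hy
    exact hax.trans_le (hf ⟨hy.1, hy.2.le.trans hx.2⟩ hx hy.2.le)
  · filter_upwards [Ioo_mem_nhdsGT hξ] with y hy
    exact (hle y ⟨hy.1, hy.2.le⟩).trans_lt ha

theorem exists_tendsto_atTop_of_monotoneOn {f : ℝ → ℝ≥0∞} {ξ : ℝ} (hf : MonotoneOn f (Ioi ξ)) :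
    ∃ l : ℝ≥0∞, Tendsto f atTop (𝓝 l) ∧ ∀ x ∈ Ioi ξ, f x ≤ l := by
  have hle : ∀ x ∈ Ioi ξ, f x ≤ ⨆ y ∈ Ioi ξ, f y := fun x hx =>
    le_iSup₂ (f := fun y _ => f y) x hx
  refine ⟨⨆ x ∈ Ioi ξ, f x, tendsto_order.2 ⟨fun a ha => ?_, fun a ha => ?_⟩, hle⟩
  · obtain ⟨x, hx, hax⟩ := lt_biSup_iff.1 ha
    filter_upwards [eventually_ge_atTop x] with y hy
    exact hax.trans_le (hf hx (lt_of_lt_of_le hx hy) hy)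
  · filter_upwards [eventually_gt_atTop ξ] with y hy
    exact (hle y hy).trans_lt ha

theorem le_toReal_of_lossE_le {L : ℝ → ℝ} {x : ℝ} (hx : 0 < x) {l : ℝ≥0∞} (hl : l ≠ ⊤)
    (h : lossE L x ≤ l) : L x ≤ l.toReal := by
  rw [lossE_of_pos L hx] at h
  exact (ENNReal.ofReal_le_iff_le_toReal hl).1 h

theorem asympRisk_lt_top {r : ℕ} (hr : 1 ≤ r) {L : ℝ → ℝ}
    (hL : ∀ x : ℝ, 0 < x → 0 ≤ L x) (h1 : LocBV L) (h2 : FinDisc L) (h3 : ThetaBounds r L)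
    {Ω : ℝ} (hΩ : 0 < Ω) : asympRisk r L Ω < ⊤ := by
  rw [asympRisk_eq_ofReal hr hL h1 h2 h3 hΩ]
  exact ENNReal.ofReal_lt_top

/-- The asymptotic risk takes values below the limit of the loss at `0`. -/
theorem exists_tendsto_zero_asympRisk_lt {r : ℕ} (hr : 1 ≤ r) {L : ℝ → ℝ}
    (hL : ∀ x : ℝ, 0 < x → 0 ≤ L x) (h1 : LocBV L) (h2 : FinDisc L) (h3 : ThetaBounds r L)
    (h4 : LeftCond r L) :
    ∃ l : ℝ≥0∞, Tendsto (lossE L) (𝓝[>] 0) (𝓝 l) ∧ ∃ Ω : ℝ, 0 < Ω ∧ asympRisk r L Ω < l := by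
  obtain ⟨ξ, hξ, hanti, hint⟩ := h4
  have ha : AntitoneOn (lossE L) (Ioc 0 ξ) := fun x hx y hy hxy => by
    rw [lossE_of_pos L hx.1, lossE_of_pos L hy.1]
    exact ENNReal.ofReal_le_ofReal (hanti hx hy hxy)
  obtain ⟨l, hl, hle⟩ := exists_tendsto_nhdsGT_zero_of_antitoneOn hξ ha
  refine ⟨l, hl, ?_⟩
  by_cases htop : l = ⊤
  · exact ⟨1, one_pos, htop ▸ asympRisk_lt_top hr hL h1 h2 h3 one_pos⟩
  · rw [← ENNReal.ofReal_toReal htop]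
    exact exists_asympRisk_lt_of_le_near_zero hr hL h1 h2 h3 hξ
      (fun x hx => le_toReal_of_lossE_le hx.1 htop (hle x hx)) hint

/-- A smooth increase at `a` forces the loss to be non-constant on `(a, ∞)`: otherwise all its
derivatives would vanish at `a` by continuity. -/
theorem SmoothUp.exists_lt {L : ℝ → ℝ} {a : ℝ} (h : SmoothUp L a) (hm : MonotoneOn L (Ioi a)) :
    ∃ x y : ℝ, a < x ∧ x < y ∧ L x < L y := by
  obtain ⟨t, ht, ⟨b, c, -, hba, hac, hC⟩, -, hpos⟩ := h
  by_contra! hcon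
  have hconst : ∀ x ∈ Ioi a, ∀ y ∈ Ioi a, L x = L y := by
    have : ∀ x ∈ Ioi a, ∀ y ∈ Ioi a, x < y → L x = L y := fun x hx y hy hxy =>
      le_antisymm (hm hx hy hxy.le) (hcon x y hx hxy)
    intro x hx y hy
    rcases lt_trichotomy x y with h | rfl | h
    · exact this x hx y hy h
    · rfl
    · exact (this y hy x hx h).symm
  have hzero : ∀ x ∈ Ioi a, iteratedDeriv t L x = 0 := by
    intro x hx
    have he : L =ᶠ[𝓝 x] fun _ => L x := by
      filter_upwards [Ioi_mem_nhds hx] with y hy using hconst y hy x hx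
    rw [he.iteratedDeriv_eq t, iteratedDeriv_const, if_neg (by omega)]
  have hcont : ContinuousAt (iteratedDeriv t L) a := by
    have h1 : ContinuousOn (iteratedDerivWithin t L (Ioo b c)) (Ioo b c) :=
      hC.continuousOn_iteratedDerivWithin le_rfl (uniqueDiffOn_Ioo b c)
    have h2 : EqOn (iteratedDerivWithin t L (Ioo b c)) (iteratedDeriv t L) (Ioo b c) :=
      iteratedDerivWithin_of_isOpen isOpen_Ioo
    exact (h1.congr h2.symm).continuousAt (Ioo_mem_nhds hba hac)
  have h0 : iteratedDeriv t L a = 0 := by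
    refine tendsto_nhds_unique (f := iteratedDeriv t L) (l := 𝓝[>] a)
      (hcont.tendsto.mono_left nhdsWithin_le_nhds) (tendsto_const_nhds.congr' ?_)
    filter_upwards [self_mem_nhdsWithin] with x hx using (hzero x hx).symm
  rw [h0, mul_zero] at hpos
  exact lt_irrefl _ hpos

/-- The asymptotic risk takes values below the limit of the loss at `∞`. -/
theorem exists_tendsto_atTop_asympRisk_lt {r : ℕ} (hr : 1 ≤ r) {L : ℝ → ℝ}
    (hL : ∀ x : ℝ, 0 < x → 0 ≤ L x) (h1 : LocBV L) (h2 : FinDisc L) (h3 : ThetaBounds r L)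
    (h4 : RightCond L) :
    ∃ l : ℝ≥0∞, Tendsto (lossE L) atTop (𝓝 l) ∧ ∃ Ω : ℝ, 0 < Ω ∧ asympRisk r L Ω < l := by
  obtain ⟨a, ha, hmono, hup⟩ := h4
  have hm : MonotoneOn (lossE L) (Ioi a) := fun x hx y hy hxy => by
    rw [lossE_of_pos L (ha.trans hx), lossE_of_pos L (ha.trans hy)]
    exact ENNReal.ofReal_le_ofReal (hmono hx hy hxy)
  obtain ⟨l, hl, hle⟩ := exists_tendsto_atTop_of_monotoneOn hm
  refine ⟨l, hl, ?_⟩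
  by_cases htop : l = ⊤
  · exact ⟨1, one_pos, htop ▸ asympRisk_lt_top hr hL h1 h2 h3 one_pos⟩
  have hle' : ∀ x, a < x → L x ≤ l.toReal := fun x hx =>
    le_toReal_of_lossE_le (ha.trans hx) htop (hle x hx)
  rw [← ENNReal.ofReal_toReal htop]
  rcases hup with ⟨u, v, hu, hv, huv⟩ | hs
  · have hvl : v ≤ l.toReal := by
      refine le_of_tendsto hv ?_
      filter_upwards [self_mem_nhdsWithin] with x hx using hle' x hx
    have hev := hu.eventually (gt_mem_nhds (show u < u + (v - u) / 2 by linarith))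
    obtain ⟨c', hc', hcs⟩ := (mem_nhdsLT_iff_exists_Ioo_subset' (sub_one_lt a)).1 hev
    have hc'a : c' < a := hc'
    have hpos : 0 < max c' (a / 2) := lt_max_of_lt_right (by linarith)
    have hlt : max c' (a / 2) < a := max_lt hc'a (by linarith)
    have hsmall : ∀ x ∈ Ioo (max c' (a / 2)) a, L x ≤ l.toReal - (v - u) / 2 := by
      intro x hx
      have : L x < u + (v - u) / 2 := hcs ⟨(le_max_left _ _).trans_lt hx.1, hx.2⟩
      linarith
    -- nothing is known about the value of the loss at the jump `a` itself
    refine exists_asympRisk_lt_of_le_near_top hr hL h1 h2 h3 hpos hlt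
      (show 0 < (v - u) / 2 by linarith) (fun x hx hxa => ?_) hsmall
    rcases lt_or_gt_of_ne hxa with h | h
    · have := hsmall x ⟨hx, h⟩
      linarith
    · exact hle' x h
  · obtain ⟨x, y, hax, hxy, hLxy⟩ := hs.exists_lt hmono
    have hy := hle' y (hax.trans hxy)
    refine exists_asympRisk_lt_of_le_near_top hr hL h1 h2 h3 (c := (a + x) / 2) (d := x)
      (ε := l.toReal - L x) (by linarith) (by linarith) (by linarith)
      (fun z hz _ => hle' z (by linarith)) (fun z hz => ?_)
    have hz1 := hz.1
    have : L z ≤ L x := hmono (show a < z by linarith) hax hz.2.le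
    linarith

/-! ### Compactness of the parameter -/

/-- The part of the asymptotic risk that comes from `ν ∈ [a, b]`. -/
noncomputable def truncRisk (r : ℕ) (L : ℝ → ℝ) (a b Ω : ℝ) : ℝ≥0∞ :=
  ∫⁻ ν in Icc a b, ENNReal.ofReal (phi r ν) * lossE L (Ω / ν)

theorem truncRisk_le_asympRisk (r : ℕ) (L : ℝ → ℝ) {a : ℝ} (ha : 0 < a) (b : ℝ) {Ω : ℝ}
    (hΩ : 0 < Ω) : truncRisk r L a b Ω ≤ asympRisk r L Ω := by
  rw [asympRisk_eq r L hΩ]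
  have hsub : Icc a b ⊆ Ioi 0 := fun ν hν => ha.trans_le hν.1
  exact lintegral_mono_set hsub

theorem measurable_phi_mul_lossE (r : ℕ) {L : ℝ → ℝ} (h2 : FinDisc L) (Ω : ℝ) :
    Measurable fun ν : ℝ => ENNReal.ofReal (phi r ν) * lossE L (Ω / ν) :=
  (continuous_phi r).measurable.ennreal_ofReal.mul
    (h2.measurable_lossE.comp (measurable_const.div measurable_id))

/-- Fatou's lemma along parameters `Ω k` and truncations `[a k, b k]` that exhaust `(0, ∞)`. -/
theorem lintegral_phi_mul_le_of_truncRisk_le (r : ℕ) {L : ℝ → ℝ} (h2 : FinDisc L)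
    {a b Ω : ℕ → ℝ} {c : ℕ → ℝ≥0∞} {C : ℝ≥0∞} {ψ : ℝ → ℝ≥0∞}
    (hab : ∀ ν : ℝ, 0 < ν → ∀ᶠ k in atTop, ν ∈ Icc (a k) (b k))
    (hψ : ∀ᵐ ν ∂(volume.restrict (Ioi (0 : ℝ))),
      Tendsto (fun k => lossE L (Ω k / ν)) atTop (𝓝 (ψ ν)))
    (hle : ∀ k, truncRisk r L (a k) (b k) (Ω k) ≤ c k) (hc : Tendsto c atTop (𝓝 C)) :
    ∫⁻ ν in Ioi (0 : ℝ), ENNReal.ofReal (phi r ν) * ψ ν ≤ C := by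
  set F : ℕ → ℝ → ℝ≥0∞ := fun k => (Icc (a k) (b k)).indicator
    fun ν => ENNReal.ofReal (phi r ν) * lossE L (Ω k / ν) with hF
  have hFm : ∀ k, Measurable (F k) := fun k =>
    (measurable_phi_mul_lossE r h2 (Ω k)).indicator measurableSet_Icc
  calc ∫⁻ ν in Ioi (0 : ℝ), ENNReal.ofReal (phi r ν) * ψ ν
      = ∫⁻ ν in Ioi (0 : ℝ), liminf (fun k => F k ν) atTop := by
        refine lintegral_congr_ae ?_
        filter_upwards [hψ, ae_restrict_mem measurableSet_Ioi] with ν hν hν0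
        refine (Tendsto.liminf_eq ?_).symm
        refine (ENNReal.Tendsto.const_mul hν (Or.inr ENNReal.ofReal_ne_top)).congr' ?_
        filter_upwards [hab ν hν0] with k hk
        simp only [hF, indicator_of_mem hk]
    _ ≤ liminf (fun k => ∫⁻ ν in Ioi (0 : ℝ), F k ν) atTop := lintegral_liminf_le hFm
    _ ≤ liminf c atTop := by
        refine liminf_le_liminf (Eventually.of_forall fun k => ?_)
        refine le_trans ?_ (hle k)
        rw [truncRisk, ← lintegral_indicator measurableSet_Icc]
        exact setLIntegral_le_lintegral _ _
    _ = C := hc.liminf_eq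

/-- Compactness: parameters `Ω k` whose truncated risks are asymptotically at most `C` yield a
single parameter with asymptotic risk at most `C`. A subsequence of `Ω k` converges in `[0, ∞]`, and
the limits `0` and `∞` can be replaced by a positive real number, because the limit of the loss
there exceeds some value of the asymptotic risk. -/
theorem exists_asympRisk_le {r : ℕ} (hr : 1 ≤ r) {L : ℝ → ℝ}
    (hL : ∀ x : ℝ, 0 < x → 0 ≤ L x) (h1 : LocBV L) (h2 : FinDisc L) (h3 : ThetaBounds r L)
    (h4l : LeftCond r L) (h4r : RightCond L) {a b Ω : ℕ → ℝ} {c : ℕ → ℝ≥0∞} {C : ℝ≥0∞}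
    (hab : ∀ ν : ℝ, 0 < ν → ∀ᶠ k in atTop, ν ∈ Icc (a k) (b k)) (hΩ : ∀ k, 0 < Ω k)
    (hle : ∀ k, truncRisk r L (a k) (b k) (Ω k) ≤ c k) (hc : Tendsto c atTop (𝓝 C)) :
    ∃ Ω' : ℝ, 0 < Ω' ∧ asympRisk r L Ω' ≤ C := by
  obtain ⟨z, φ, hφ, hz⟩ := CompactSpace.tendsto_subseq fun k => ENNReal.ofReal (Ω k)
  have key : ∀ ψ : ℝ → ℝ≥0∞, (∀ᵐ ν ∂(volume.restrict (Ioi (0 : ℝ))),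
      Tendsto (fun k => lossE L (Ω (φ k) / ν)) atTop (𝓝 (ψ ν))) →
      ∫⁻ ν in Ioi (0 : ℝ), ENNReal.ofReal (phi r ν) * ψ ν ≤ C := fun ψ hψ =>
    lintegral_phi_mul_le_of_truncRisk_le r h2
      (fun ν hν => hφ.tendsto_atTop.eventually (hab ν hν)) hψ (fun k => hle (φ k))
      (hc.comp hφ.tendsto_atTop)
  -- a constant limit integrates to itself against the Gamma density
  have key' : ∀ l : ℝ≥0∞, (∀ ν : ℝ, 0 < ν →
      Tendsto (fun k => lossE L (Ω (φ k) / ν)) atTop (𝓝 l)) → l ≤ C := fun l hl => by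
    have := key (fun _ => l) (by
      filter_upwards [ae_restrict_mem measurableSet_Ioi] with ν hν using hl ν hν)
    rwa [lintegral_mul_const _ (continuous_phi r).measurable.ennreal_ofReal, lintegral_phi,
      one_mul] at this
  by_cases htop : z = ⊤
  · obtain ⟨l, hl, Ω', hΩ', hlt⟩ := exists_tendsto_atTop_asympRisk_lt hr hL h1 h2 h3 h4r
    refine ⟨Ω', hΩ', hlt.le.trans (key' l fun ν hν => hl.comp ?_)⟩
    have : Tendsto (fun k => Ω (φ k)) atTop atTop := by
      rw [← ENNReal.tendsto_ofReal_nhds_top]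
      exact htop ▸ hz
    exact this.atTop_div_const hν
  have hreal : Tendsto (fun k => Ω (φ k)) atTop (𝓝 z.toReal) := by
    refine ((ENNReal.tendsto_toReal htop).comp hz).congr fun k => ?_
    simp only [Function.comp_apply]
    rw [ENNReal.toReal_ofReal (hΩ _).le]
  rcases (ENNReal.toReal_nonneg (a := z)).eq_or_lt with h0 | hpos
  · obtain ⟨l, hl, Ω', hΩ', hlt⟩ := exists_tendsto_zero_asympRisk_lt hr hL h1 h2 h3 h4l
    refine ⟨Ω', hΩ', hlt.le.trans (key' l fun ν hν => hl.comp ?_)⟩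
    refine tendsto_nhdsWithin_iff.2 ⟨?_, Eventually.of_forall fun k => div_pos (hΩ _) hν⟩
    have := hreal.div_const ν
    rwa [← h0, zero_div] at this
  · refine ⟨z.toReal, hpos, ?_⟩
    rw [asympRisk_eq r L hpos]
    refine key (fun ν => lossE L (z.toReal / ν)) ?_
    filter_upwards [h2.ae_continuousAt_div hpos, ae_restrict_mem measurableSet_Ioi] with ν hν hν0
    exact tendsto_lossE (div_pos hpos hν0) hν (hreal.div_const ν)

theorem eventually_mem_Icc_inv_nat {ν : ℝ} (hν : 0 < ν) :
    ∀ᶠ k : ℕ in atTop, ν ∈ Icc (1 / ((k : ℝ) + 1)) ((k : ℝ) + 1) := by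
  filter_upwards [tendsto_one_div_add_atTop_nhds_zero_nat.eventually (gt_mem_nhds hν),
    tendsto_natCast_atTop_atTop.eventually (eventually_ge_atTop ν)] with k hk1 hk2
  exact ⟨hk1.le, by linarith⟩

/-- The asymptotic risk attains its minimum. -/
theorem exists_asympRisk_min {r : ℕ} (hr : 1 ≤ r) {L : ℝ → ℝ}
    (hL : ∀ x : ℝ, 0 < x → 0 ≤ L x) (h1 : LocBV L) (h2 : FinDisc L) (h3 : ThetaBounds r L)
    (h4l : LeftCond r L) (h4r : RightCond L) :
    ∃ Ω₀ : ℝ, 0 < Ω₀ ∧ ∀ Ω : ℝ, 0 < Ω → asympRisk r L Ω₀ ≤ asympRisk r L Ω := by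
  set S : Set ℝ≥0∞ := asympRisk r L '' Ioi 0 with hS
  have hne : S.Nonempty := nonempty_Ioi.image _
  obtain ⟨u, -, hu, huS⟩ := exists_seq_tendsto_sInf hne (OrderBot.bddBelow S)
  choose Ω hΩ hΩu using huS
  obtain ⟨Ω₀, hΩ₀, hle⟩ := exists_asympRisk_le hr hL h1 h2 h3 h4l h4r
    (fun ν hν => eventually_mem_Icc_inv_nat hν) hΩ
    (fun k => (truncRisk_le_asympRisk r L (by positivity) _ (hΩ k)).trans (hΩu k).le) hu
  exact ⟨Ω₀, hΩ₀, fun Ω' hΩ' => hle.trans (sInf_le (mem_image_of_mem _ hΩ'))⟩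

/-- Truncating the asymptotic risk to a large compact interval costs little, uniformly in `Ω`. -/
theorem exists_forall_lt_truncRisk {r : ℕ} (hr : 1 ≤ r) {L : ℝ → ℝ}
    (hL : ∀ x : ℝ, 0 < x → 0 ≤ L x) (h1 : LocBV L) (h2 : FinDisc L) (h3 : ThetaBounds r L)
    (h4l : LeftCond r L) (h4r : RightCond L) {η : ℝ≥0∞}
    (hη : ∀ Ω : ℝ, 0 < Ω → η < asympRisk r L Ω) :
    ∃ a b : ℝ, 0 < a ∧ a ≤ b ∧ ∀ Ω : ℝ, 0 < Ω → η < truncRisk r L a b Ω := by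
  by_contra! hcon
  have hk : ∀ k : ℕ, 0 < 1 / ((k : ℝ) + 1) ∧ 1 / ((k : ℝ) + 1) ≤ (k : ℝ) + 1 := fun k => by
    have h0 : (0 : ℝ) ≤ k := k.cast_nonneg
    refine ⟨by positivity, ?_⟩
    rw [div_le_iff₀ (by positivity)]
    nlinarith
  choose Ω hΩ hle using fun k : ℕ => hcon (1 / ((k : ℝ) + 1)) ((k : ℝ) + 1) (hk k).1 (hk k).2
  obtain ⟨Ω', hΩ', hle'⟩ := exists_asympRisk_le hr hL h1 h2 h3 h4l h4r
    (fun ν hν => eventually_mem_Icc_inv_nat hν) hΩ hle tendsto_const_nhds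
  exact absurd (hη Ω' hΩ') (not_lt.2 hle')

/-! ### The negative binomial law against the Gamma law -/

theorem pmfN_nonneg (r : ℕ) {p : ℝ} (hp0 : 0 ≤ p) (hp1 : p ≤ 1) (n : ℕ) : 0 ≤ pmfN r p n := by
  have : 0 ≤ 1 - p := by linarith
  unfold pmfN; positivity

/-- The negative binomial probabilities are at most the Gamma density with step `p`, up to a factor
that tends to `1` as `p → 0`. -/
theorem pmfN_le {r : ℕ} (hr : 1 ≤ r) {p : ℝ} (hp0 : 0 < p) (hp1 : p < 1) {n : ℕ} (hn : r ≤ n) :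
    pmfN r p n ≤ p * phi r (n * p) * Real.exp (r * p) := by
  obtain ⟨k, rfl⟩ : ∃ k, r = k + 1 := ⟨r - 1, by omega⟩
  have hn0 : 1 ≤ n := by omega
  have hq : 0 ≤ 1 - p := by linarith
  have hc : ((n - 1).choose k : ℝ) ≤ (n : ℝ) ^ k / (k.factorial : ℝ) := by
    refine (Nat.choose_le_pow_div k (n - 1)).trans ?_
    have : ((n - 1 : ℕ) : ℝ) ≤ n := by exact_mod_cast Nat.sub_le n 1
    gcongr
  have he : (1 - p) ^ (n - (k + 1)) ≤ Real.exp (-(n * p)) * Real.exp (((k + 1 : ℕ) : ℝ) * p) := by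
    calc (1 - p) ^ (n - (k + 1)) ≤ Real.exp (-p) ^ (n - (k + 1)) :=
          pow_le_pow_left₀ hq (Real.one_sub_le_exp_neg p) _
      _ = Real.exp (-(n * p)) * Real.exp (((k + 1 : ℕ) : ℝ) * p) := by
          rw [← Real.exp_nat_mul, ← Real.exp_add, Nat.cast_sub hn]
          congr 1; ring
  unfold pmfN phi
  rw [Nat.add_sub_cancel]
  calc ((n - 1).choose k : ℝ) * p ^ (k + 1) * (1 - p) ^ (n - (k + 1))
      ≤ ((n : ℝ) ^ k / (k.factorial : ℝ)) * p ^ (k + 1) *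
          (Real.exp (-(n * p)) * Real.exp (((k + 1 : ℕ) : ℝ) * p)) := by gcongr
    _ = _ := by rw [mul_pow]; ring

/-- The correction factor, tending to `1` as `n → ∞`, in the lower bound `le_pmfN`; it is uniform in
`p` as long as `n * p ≤ b`. -/
noncomputable def pmfFactor (r : ℕ) (b : ℝ) (n : ℕ) : ℝ :=
  (1 - (r : ℝ) / n) ^ (r - 1) * (1 - b ^ 2 / n)

theorem tendsto_pmfFactor (r : ℕ) (b : ℝ) : Tendsto (pmfFactor r b) atTop (𝓝 1) := by
  have h1 := tendsto_const_div_atTop_nhds_zero_nat (r : ℝ)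
  have h2 := tendsto_const_div_atTop_nhds_zero_nat (b ^ 2)
  have := ((h1.const_sub 1).pow (r - 1)).mul (h2.const_sub 1)
  simp only [sub_zero, one_pow, one_mul] at this
  exact this

theorem exp_neg_mul_le_one_sub_pow {p : ℝ} (hp0 : 0 < p) (hp1 : p < 1) (n : ℕ) :
    Real.exp (-(n * p)) * (1 - n * p ^ 2) ≤ (1 - p) ^ n := by
  have hq : 0 ≤ 1 - p := by linarith
  have h1 : 1 - n * p ^ 2 ≤ (1 - p) ^ n * Real.exp (n * p) := by
    calc 1 - n * p ^ 2 = 1 + n * (-p ^ 2) := by ring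
      _ ≤ (1 + -p ^ 2) ^ n := one_add_mul_le_pow (by nlinarith) n
      _ = (1 - p) ^ n * (p + 1) ^ n := by rw [← mul_pow]; congr 1; ring
      _ ≤ (1 - p) ^ n * Real.exp p ^ n := by
          gcongr
          exact Real.add_one_le_exp p
      _ = _ := by rw [← Real.exp_nat_mul]
  calc Real.exp (-(n * p)) * (1 - n * p ^ 2)
      ≤ Real.exp (-(n * p)) * ((1 - p) ^ n * Real.exp (n * p)) := by gcongr
    _ = (1 - p) ^ n * (Real.exp (-(n * p)) * Real.exp (n * p)) := by ring
    _ = _ := by rw [← Real.exp_add, neg_add_cancel, Real.exp_zero, mul_one]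

/-- A lower bound by the Gamma density with step `p`. If `pmfFactor` is negative it is trivial. -/
theorem le_pmfN {r : ℕ} (hr : 1 ≤ r) {p b : ℝ} (hp0 : 0 < p) (hp1 : p < 1) {n : ℕ} (hn : r ≤ n)
    (hb : n * p ≤ b) : p * phi r (n * p) * pmfFactor r b n ≤ pmfN r p n := by
  obtain ⟨k, rfl⟩ : ∃ k, r = k + 1 := ⟨r - 1, by omega⟩
  have hn0 : (0 : ℝ) < n := by exact_mod_cast (show 0 < n by omega)
  have hq : 0 ≤ 1 - p := by linarith
  have hnk : ((k + 1 : ℕ) : ℝ) ≤ n := by exact_mod_cast hn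
  have hfac : 0 ≤ 1 - ((k + 1 : ℕ) : ℝ) / n := by
    rw [sub_nonneg, div_le_one hn0]; exact hnk
  have hc : ((n : ℝ) * (1 - ((k + 1 : ℕ) : ℝ) / n)) ^ k / (k.factorial : ℝ) ≤
      ((n - 1).choose k : ℝ) := by
    refine le_trans ?_ (Nat.pow_le_choose k (n - 1))
    have e : (n : ℝ) * (1 - ((k + 1 : ℕ) : ℝ) / n) ≤ ((n - 1 + 1 - k : ℕ) : ℝ) := by
      rw [Nat.cast_sub (by omega), Nat.sub_add_cancel (by omega)]
      have : (n : ℝ) * (1 - ((k + 1 : ℕ) : ℝ) / n) = n - ((k + 1 : ℕ) : ℝ) := by field_simp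
      rw [this]; push_cast; linarith
    gcongr
  have he : Real.exp (-(n * p)) * (1 - b ^ 2 / n) ≤ (1 - p) ^ (n - (k + 1)) := by
    have h1 : (n : ℝ) * p ^ 2 ≤ b ^ 2 / n := by
      rw [le_div_iff₀ hn0]
      calc (n : ℝ) * p ^ 2 * n = (n * p) ^ 2 := by ring
        _ ≤ b ^ 2 := by gcongr
    calc Real.exp (-(n * p)) * (1 - b ^ 2 / n) ≤ Real.exp (-(n * p)) * (1 - n * p ^ 2) := by
          gcongr
      _ ≤ (1 - p) ^ n := exp_neg_mul_le_one_sub_pow hp0 hp1 n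
      _ ≤ (1 - p) ^ (n - (k + 1)) := pow_le_pow_of_le_one hq (by linarith) (Nat.sub_le _ _)
  unfold pmfN phi pmfFactor
  rw [Nat.add_sub_cancel]
  calc p * ((n * p) ^ k * Real.exp (-(n * p)) / (k.factorial : ℝ)) *
        ((1 - ((k + 1 : ℕ) : ℝ) / n) ^ k * (1 - b ^ 2 / n))
      = ((n : ℝ) * (1 - ((k + 1 : ℕ) : ℝ) / n)) ^ k / (k.factorial : ℝ) * p ^ (k + 1) *
          (Real.exp (-(n * p)) * (1 - b ^ 2 / n)) := by rw [mul_pow, mul_pow]; ring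
    _ ≤ ((n : ℝ) * (1 - ((k + 1 : ℕ) : ℝ) / n)) ^ k / (k.factorial : ℝ) * p ^ (k + 1) *
          (1 - p) ^ (n - (k + 1)) := by gcongr
    _ ≤ _ := by gcongr

/-! ### The estimator `Ω / N` -/

/-- The non-randomized estimator `Ω / N`. -/
noncomputable def ratioEstimator {r : ℕ} (hr : 1 ≤ r) {Ω : ℝ} (hΩ : 0 < Ω) : Estimator r where
  law n := Measure.dirac (Ω / n)
  isProb _ _ := inferInstance
  pos n hn := by
    have : (0 : ℝ) < n := by exact_mod_cast (show 0 < n by omega)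
    rw [Measure.dirac_apply' _ measurableSet_Iic, indicator_of_notMem]
    exact not_le.2 (div_pos hΩ this)

theorem lintegral_floor_div {p : ℝ} (hp : 0 < p) (a : ℕ → ℝ≥0∞) :
    ∫⁻ ν in Ioi (0 : ℝ), a ⌊ν / p⌋₊ = ∑' j, ENNReal.ofReal p * a j := by
  have hU : Ici (0 : ℝ) = ⋃ j : ℕ, Ico (j * p) ((j + 1) * p) := by
    ext ν
    simp only [mem_Ici, mem_iUnion, mem_Ico]
    constructor
    · intro h
      refine ⟨⌊ν / p⌋₊, ?_, ?_⟩
      · rw [← le_div_iff₀ hp]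
        exact Nat.floor_le (by positivity)
      · rw [← div_lt_iff₀ hp]
        exact Nat.lt_floor_add_one _
    · rintro ⟨j, hj, -⟩
      exact le_trans (by positivity) hj
  have hfl : ∀ j : ℕ, ∀ ν ∈ Ico ((j : ℝ) * p) ((j + 1) * p), ⌊ν / p⌋₊ = j := by
    intro j ν hν
    rw [Nat.floor_eq_iff (div_nonneg (le_trans (by positivity) hν.1) hp.le)]
    exact ⟨(le_div_iff₀ hp).2 hν.1, (div_lt_iff₀ hp).2 hν.2⟩
  rw [setLIntegral_congr Ioi_ae_eq_Ici, hU, lintegral_iUnion (fun _ => measurableSet_Ico)]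
  · refine tsum_congr fun j => ?_
    rw [setLIntegral_congr_fun (g := fun _ => a j) measurableSet_Ico
      (fun ν hν => by rw [hfl j ν hν]), setLIntegral_const, Real.volume_Ico, mul_comm]
    congr 2; ring
  · intro i j hij
    rw [Function.onFun, Set.disjoint_left]
    intro ν hi hj
    exact hij ((hfl i ν hi).symm.trans (hfl j ν hj))

/-- The risk of `Ω / N` as the integral of a step function with steps of length `p`; the number of
trials that belongs to `ν` is `⌊ν / p⌋ + 1`. -/
theorem risk_ratioEstimator {r : ℕ} (hr : 1 ≤ r) (L : ℝ → ℝ) {Ω : ℝ} (hΩ : 0 < Ω) {p : ℝ}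
    (hp : 0 < p) :
    risk r L (ratioEstimator hr hΩ) p = ∫⁻ ν in Ioi (0 : ℝ),
      ENNReal.ofReal (pmfN r p (⌊ν / p⌋₊ + 1) / p) *
        lossE L (Ω / (((⌊ν / p⌋₊ + 1 : ℕ) : ℝ) * p)) := by
  set A : ℕ → ℝ≥0∞ := fun j => ENNReal.ofReal (pmfN r p (j + 1)) *
    lossE L (Ω / (((j + 1 : ℕ) : ℝ) * p)) with hA
  rw [lintegral_floor_div hp (fun j => ENNReal.ofReal (pmfN r p (j + 1) / p) *
        lossE L (Ω / (((j + 1 : ℕ) : ℝ) * p)))]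
  have e1 : ∀ j : ℕ, ENNReal.ofReal p * (ENNReal.ofReal (pmfN r p (j + 1) / p) *
        lossE L (Ω / (((j + 1 : ℕ) : ℝ) * p))) = A j := by
    intro j
    rw [← mul_assoc, ← ENNReal.ofReal_mul hp.le, mul_div_cancel₀ _ hp.ne']
  rw [tsum_congr e1, ← (ENNReal.summable (f := fun k => A (k + (r - 1)))).sum_add_tsum_nat_add']
  -- `pmfN` vanishes for `1 ≤ n < r`, so the sum may start at `n = 1`
  have e2 : ∑ i ∈ Finset.range (r - 1), A i = 0 := by
    refine Finset.sum_eq_zero fun i hi => ?_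
    have hi := Finset.mem_range.1 hi
    simp only [hA, pmfN, Nat.add_sub_cancel, Nat.choose_eq_zero_of_lt hi]
    simp
  rw [e2, zero_add]
  refine tsum_congr fun k => ?_
  have e3 : k + (r - 1) + 1 = r + k := by omega
  have hpos : (0 : ℝ) < ((r + k : ℕ) : ℝ) := by exact_mod_cast (show 0 < r + k by omega)
  have hx : Ω / ((r + k : ℕ) : ℝ) ∈ Ioi (0 : ℝ) := div_pos hΩ hpos
  simp only [hA, e3]
  congr 1
  change ∫⁻ y in Ioi (0 : ℝ), ENNReal.ofReal (L (y / p))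
    ∂(Measure.dirac (Ω / ((r + k : ℕ) : ℝ))) = _
  classical
  rw [restrict_dirac' measurableSet_Ioi, if_pos hx, lintegral_dirac,
    lossE_of_pos L (by positivity), div_div]

theorem tendsto_floor_mul (ν : ℝ) (hν : 0 < ν) :
    Tendsto (fun p : ℝ => ((⌊ν / p⌋₊ + 1 : ℕ) : ℝ) * p) (𝓝[>] 0) (𝓝 ν) := by
  have hup : Tendsto (fun p : ℝ => ν + p) (𝓝[>] 0) (𝓝 ν) := by
    have : Tendsto (fun p : ℝ => ν + p) (𝓝 0) (𝓝 (ν + 0)) := (continuous_const_add ν).tendsto 0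
    rw [add_zero] at this
    exact this.mono_left nhdsWithin_le_nhds
  refine tendsto_of_tendsto_of_tendsto_of_le_of_le' tendsto_const_nhds hup ?_ ?_
  · filter_upwards [self_mem_nhdsWithin] with p hp
    have hp : 0 < p := hp
    have := (Nat.lt_floor_add_one (ν / p)).le
    rw [div_le_iff₀ hp] at this
    exact_mod_cast this
  · filter_upwards [self_mem_nhdsWithin] with p hp
    have hp : 0 < p := hp
    have := Nat.floor_le (div_nonneg hν.le hp.le)
    rw [le_div_iff₀ hp] at this
    push_cast
    linarith

theorem tendsto_pmfN_div {r : ℕ} (hr : 1 ≤ r) {ν : ℝ} (hν : 0 < ν) :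
    Tendsto (fun p : ℝ => pmfN r p (⌊ν / p⌋₊ + 1) / p) (𝓝[>] 0) (𝓝 (phi r ν)) := by
  have hN := tendsto_floor_mul ν hν
  have hNtop : Tendsto (fun p : ℝ => ⌊ν / p⌋₊ + 1) (𝓝[>] 0) atTop := by
    have h1 : Tendsto (fun p : ℝ => ν / p) (𝓝[>] 0) atTop :=
      tendsto_inv_nhdsGT_zero.const_mul_atTop hν
    exact (tendsto_add_atTop_nat 1).comp (tendsto_nat_floor_atTop.comp h1)
  have hphi := ((continuous_phi r).tendsto ν).comp hN
  have hlo := hphi.mul ((tendsto_pmfFactor r (ν + 1)).comp hNtop)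
  have hexp : Tendsto (fun p : ℝ => Real.exp (r * p)) (𝓝[>] 0) (𝓝 1) := by
    have hc : Continuous fun p : ℝ => Real.exp (r * p) := by fun_prop
    have := hc.tendsto 0
    rw [mul_zero, Real.exp_zero] at this
    exact this.mono_left nhdsWithin_le_nhds
  have hhi := hphi.mul hexp
  rw [mul_one] at hlo hhi
  have hp1 : ∀ᶠ p : ℝ in 𝓝[>] 0, p ∈ Ioo (0 : ℝ) 1 := Ioo_mem_nhdsGT one_pos
  refine tendsto_of_tendsto_of_tendsto_of_le_of_le' hlo hhi ?_ ?_
  · filter_upwards [hp1, hNtop.eventually (eventually_ge_atTop r),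
      hN.eventually (ge_mem_nhds (show ν < ν + 1 by linarith))] with p hp hn hb
    rw [le_div_iff₀ hp.1]
    refine le_trans (le_of_eq ?_) (le_pmfN hr hp.1 hp.2 hn hb)
    simp only [Function.comp_apply]
    ring
  · filter_upwards [hp1, hNtop.eventually (eventually_ge_atTop r)] with p hp hn
    rw [div_le_iff₀ hp.1]
    refine (pmfN_le hr hp.1 hp.2 hn).trans (le_of_eq ?_)
    simp only [Function.comp_apply]
    ring

/-- The risk of the estimator `Ω / N` converges to its asymptotic risk. -/
theorem tendsto_risk_ratioEstimator {r : ℕ} (hr : 1 ≤ r) {L : ℝ → ℝ}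
    (hL : ∀ x : ℝ, 0 < x → 0 ≤ L x) (h1 : LocBV L) (h2 : FinDisc L) (h3 : ThetaBounds r L)
    {Ω : ℝ} (hΩ : 0 < Ω) :
    Tendsto (fun p => risk r L (ratioEstimator hr hΩ) p) (𝓝[>] 0) (𝓝 (asympRisk r L Ω)) := by
  obtain ⟨k, s, C, hs1, hs0, hC, hb⟩ := exists_phi_mul_loss_le hr hL h1 h3 hΩ
  set D : ℝ → ℝ := fun ν => Real.exp r * C *
    ((ν + 1) ^ k * Real.exp (-ν) + ν ^ s * Real.exp (-ν)) with hD
  have hDint : IntegrableOn D (Ioi 0) :=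
    ((integrableOn_add_one_pow_mul_exp_neg k).add (integrableOn_rpow_mul_exp_neg hs1)).const_mul _
  have hp1 : ∀ᶠ p : ℝ in 𝓝[>] 0, p ∈ Ioo (0 : ℝ) 1 := Ioo_mem_nhdsGT one_pos
  rw [asympRisk_eq r L hΩ]
  refine Tendsto.congr' (f₁ := fun p => ∫⁻ ν in Ioi (0 : ℝ),
      ENNReal.ofReal (pmfN r p (⌊ν / p⌋₊ + 1) / p) *
        lossE L (Ω / (((⌊ν / p⌋₊ + 1 : ℕ) : ℝ) * p))) ?_ ?_
  · filter_upwards [self_mem_nhdsWithin] with p hp using (risk_ratioEstimator hr L hΩ hp).symm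
  refine tendsto_lintegral_filter_of_dominated_convergence (fun ν => ENNReal.ofReal (D ν))
    ?_ ?_ ?_ ?_
  · refine Eventually.of_forall fun p => ?_
    have hm : Measurable fun j : ℕ => ENNReal.ofReal (pmfN r p (j + 1) / p) *
        lossE L (Ω / (((j + 1 : ℕ) : ℝ) * p)) := measurable_from_nat
    exact hm.comp (Nat.measurable_floor.comp (measurable_id.div_const p))
  · filter_upwards [hp1] with p hp
    filter_upwards [ae_restrict_mem measurableSet_Ioi] with ν hν
    have hν : 0 < ν := hν
    set n : ℕ := ⌊ν / p⌋₊ + 1 with hn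
    have hlo : ν ≤ n * p := by
      have := (Nat.lt_floor_add_one (ν / p)).le
      rw [div_le_iff₀ hp.1] at this
      rw [hn]; exact_mod_cast this
    have hhi : n * p ≤ ν + 1 := by
      have := Nat.floor_le (div_nonneg hν.le hp.1.le)
      rw [le_div_iff₀ hp.1] at this
      rw [hn]; push_cast; linarith [hp.2]
    have hpos : 0 < n * p := hν.trans_le hlo
    rw [lossE_of_pos L (div_pos hΩ hpos),
      ← ENNReal.ofReal_mul (div_nonneg (pmfN_nonneg r hp.1.le hp.2.le n) hp.1.le)]
    refine ENNReal.ofReal_le_ofReal ?_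
    have hl := hL _ (div_pos hΩ hpos)
    rcases lt_or_ge n r with hnr | hnr
    · have h0 : pmfN r p n = 0 := by
        unfold pmfN
        rw [Nat.choose_eq_zero_of_lt (by omega)]
        simp
      rw [h0, zero_div, zero_mul]
      simp only [hD]; positivity
    · have hpm : pmfN r p n / p ≤ phi r (n * p) * Real.exp r := by
        rw [div_le_iff₀ hp.1]
        refine (pmfN_le hr hp.1 hp.2 hnr).trans ?_
        have h1 : Real.exp (r * p) ≤ Real.exp r :=
          Real.exp_le_exp.2 (mul_le_of_le_one_right (by positivity) hp.2.le)
        have h2 := phi_nonneg r hpos.le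
        calc p * phi r (n * p) * Real.exp (r * p) ≤ p * phi r (n * p) * Real.exp r :=
              mul_le_mul_of_nonneg_left h1 (mul_nonneg hp.1.le h2)
          _ = _ := by ring
      calc pmfN r p n / p * L (Ω / (n * p)) ≤ phi r (n * p) * Real.exp r * L (Ω / (n * p)) :=
            mul_le_mul_of_nonneg_right hpm hl
        _ = Real.exp r * (phi r (n * p) * L (Ω / (n * p))) := by ring
        _ ≤ Real.exp r * (C * ((n * p) ^ k + (n * p) ^ s) * Real.exp (-(n * p))) :=
            mul_le_mul_of_nonneg_left (hb _ hpos) (Real.exp_pos _).le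
        _ ≤ Real.exp r * (C * ((ν + 1) ^ k + ν ^ s) * Real.exp (-ν)) := by
            -- `s < 0`, so the singular factor is largest at the left end `ν`
            have := Real.rpow_le_rpow_of_nonpos hν hlo hs0.le
            gcongr
        _ = D ν := by simp only [hD]; ring
  · rw [← ofReal_integral_eq_lintegral_ofReal hDint]
    · exact ENNReal.ofReal_ne_top
    filter_upwards [ae_restrict_mem measurableSet_Ioi] with ν hν
    have hν : 0 < ν := hν
    simp only [hD, Pi.zero_apply]; positivity
  · filter_upwards [h2.ae_continuousAt_div hΩ, ae_restrict_mem measurableSet_Ioi] with ν hν hν0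
    have hν0 : 0 < ν := hν0
    have hx := tendsto_lossE (div_pos hΩ hν0) hν
      (tendsto_const_nhds.div (tendsto_floor_mul ν hν0) hν0.ne')
    exact ENNReal.Tendsto.mul (ENNReal.tendsto_ofReal (tendsto_pmfN_div hr hν0))
      (Or.inr (by rw [lossE_of_pos L (div_pos hΩ hν0)]; exact ENNReal.ofReal_ne_top)) hx
      (Or.inr ENNReal.ofReal_ne_top)

/-! ### The lower bound for arbitrary estimators -/

/-- The contribution of `N = n` to the risk, per unit of `dp / p`. -/
noncomputable def riskDensity (r : ℕ) (L : ℝ → ℝ) (μ : Measure ℝ) (n : ℕ) (p : ℝ) : ℝ≥0∞ :=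
  ENNReal.ofReal (pmfN r p n / p) * ∫⁻ y in Ioi (0 : ℝ), lossE L (y / p) ∂μ

theorem measurable_pmfN_div (r n : ℕ) : Measurable fun p : ℝ => pmfN r p n / p := by
  have : Continuous fun p : ℝ => pmfN r p n := by unfold pmfN; fun_prop
  exact this.measurable.div measurable_id

theorem measurable_riskDensity (r : ℕ) {L : ℝ → ℝ} (h2 : FinDisc L) (μ : Measure ℝ) [SFinite μ]
    (n : ℕ) : Measurable (riskDensity r L μ n) := by
  have h : Measurable fun z : ℝ × ℝ => lossE L (z.2 / z.1) :=
    h2.measurable_lossE.comp (measurable_snd.div measurable_fst)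
  exact (measurable_pmfN_div r n).ennreal_ofReal.mul h.lintegral_prod_right'

theorem sum_riskDensity_le (r : ℕ) (L : ℝ → ℝ) (G : Estimator r) {p : ℝ} (hp : 0 < p)
    (s : Finset ℕ) :
    ∑ k ∈ s, riskDensity r L (G.law (r + k)) (r + k) p ≤ ENNReal.ofReal p⁻¹ * risk r L G p := by
  rw [risk, ← ENNReal.tsum_mul_left]
  refine le_trans (le_of_eq (Finset.sum_congr rfl fun k _ => ?_)) (ENNReal.sum_le_tsum s)
  have e : ∫⁻ y in Ioi (0 : ℝ), lossE L (y / p) ∂(G.law (r + k)) =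
      ∫⁻ y in Ioi (0 : ℝ), ENNReal.ofReal (L (y / p)) ∂(G.law (r + k)) :=
    setLIntegral_congr_fun measurableSet_Ioi fun y hy => lossE_of_pos L (div_pos hy hp)
  rw [riskDensity, e, ← mul_assoc, ← ENNReal.ofReal_mul (inv_nonneg.2 hp.le), div_eq_inv_mul]

theorem setLIntegral_Icc_comp_mul {n : ℝ} (hn : 0 < n) (a b : ℝ) {g : ℝ → ℝ≥0∞}
    (hg : Measurable g) :
    ∫⁻ p in Icc (a / n) (b / n), g (n * p) = ENNReal.ofReal n⁻¹ * ∫⁻ ν in Icc a b, g ν := by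
  have h := lintegral_map (μ := volume) (hg.indicator (measurableSet_Icc (a := a) (b := b)))
    (measurable_const_mul n)
  rw [Real.map_volume_mul_left hn.ne', lintegral_smul_measure, lintegral_indicator
    measurableSet_Icc, abs_of_pos (inv_pos.2 hn), smul_eq_mul] at h
  rw [h, ← lintegral_indicator measurableSet_Icc]
  refine lintegral_congr fun p => ?_
  have hiff : p ∈ Icc (a / n) (b / n) ↔ n * p ∈ Icc a b := by
    rw [mem_Icc, mem_Icc, div_le_iff₀' hn, le_div_iff₀' hn]
  by_cases hp : p ∈ Icc (a / n) (b / n)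
  · rw [indicator_of_mem hp, indicator_of_mem (hiff.1 hp)]
  · rw [indicator_of_notMem hp, indicator_of_notMem (mt hiff.2 hp)]

/-- Averaging over `p` the loss incurred by the estimate `y` at `N = n` gives, up to the factor
`κ / n`, a truncated asymptotic risk with parameter `n * y`. -/
theorem le_setLIntegral_pmfN_mul_lossE {r : ℕ} (hr : 1 ≤ r) {L : ℝ → ℝ} (h2 : FinDisc L)
    {a b ε δ κ y : ℝ} {n : ℕ} (ha : 0 < a) (hδ : δ ≤ 1) (hκ : 0 ≤ κ) (hn : r ≤ n)
    (hε : ε < a / n) (hbδ : b / n < δ) (hfac : κ ≤ pmfFactor r b n) :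
    ENNReal.ofReal (κ / n) * truncRisk r L a b (n * y) ≤
      ∫⁻ p in Ioo ε δ, ENNReal.ofReal (pmfN r p n / p) * lossE L (y / p) := by
  have hn0 : (0 : ℝ) < n := by exact_mod_cast (show 0 < n by omega)
  have hsub : Icc (a / n) (b / n) ⊆ Ioo ε δ := Icc_subset_Ioo hε hbδ
  have hm := measurable_phi_mul_lossE r h2 (n * y)
  calc ENNReal.ofReal (κ / n) * truncRisk r L a b (n * y)
      = ENNReal.ofReal κ * ∫⁻ p in Icc (a / n) (b / n),
          ENNReal.ofReal (phi r (n * p)) * lossE L (n * y / (n * p)) := by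
        rw [setLIntegral_Icc_comp_mul hn0 a b hm, ← mul_assoc, ← ENNReal.ofReal_mul hκ,
          ← div_eq_mul_inv, truncRisk]
    _ = ∫⁻ p in Icc (a / n) (b / n), ENNReal.ofReal κ *
          (ENNReal.ofReal (phi r (n * p)) * lossE L (n * y / (n * p))) :=
        (lintegral_const_mul _ (hm.comp (measurable_const_mul (n : ℝ)))).symm
    _ ≤ ∫⁻ p in Icc (a / n) (b / n), ENNReal.ofReal (pmfN r p n / p) * lossE L (y / p) := by
        refine setLIntegral_mono' measurableSet_Icc fun p hp => ?_
        have hp0 : 0 < p := (div_pos ha hn0).trans_le hp.1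
        have hp1 : p < 1 := (hp.2.trans_lt hbδ).trans_le hδ
        have hb : n * p ≤ b := (le_div_iff₀' hn0).1 hp.2
        have h := le_pmfN hr hp0 hp1 hn hb
        have hφ := phi_nonneg r (mul_nonneg hn0.le hp0.le)
        rw [mul_div_mul_left _ _ hn0.ne', ← mul_assoc, ← ENNReal.ofReal_mul hκ]
        refine mul_le_mul_left (ENNReal.ofReal_le_ofReal ?_) _
        rw [le_div_iff₀ hp0]
        calc κ * phi r (n * p) * p = p * phi r (n * p) * κ := by ring
          _ ≤ p * phi r (n * p) * pmfFactor r b n :=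
              mul_le_mul_of_nonneg_left hfac (mul_nonneg hp0.le hφ)
          _ ≤ _ := h
    _ ≤ _ := lintegral_mono_set hsub

theorem le_setLIntegral_riskDensity {r : ℕ} (hr : 1 ≤ r) {L : ℝ → ℝ} (h2 : FinDisc L)
    {μ : Measure ℝ} [IsProbabilityMeasure μ] (hμ : μ (Iic 0) = 0)
    {a b ε δ κ : ℝ} {η : ℝ≥0∞} {n : ℕ} (ha : 0 < a) (hδ : δ ≤ 1) (hκ : 0 ≤ κ) (hn : r ≤ n)
    (hε : ε < a / n) (hbδ : b / n < δ) (hfac : κ ≤ pmfFactor r b n)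
    (hη : ∀ Ω : ℝ, 0 < Ω → η ≤ truncRisk r L a b Ω) :
    ENNReal.ofReal (κ / n) * η ≤ ∫⁻ p in Ioo ε δ, riskDensity r L μ n p := by
  have hn0 : (0 : ℝ) < n := by exact_mod_cast (show 0 < n by omega)
  have hμ1 : μ (Ioi 0) = 1 := by
    rw [← compl_Iic]
    exact (prob_compl_eq_one_iff measurableSet_Iic).2 hμ
  have hm : Measurable fun z : ℝ × ℝ =>
      ENNReal.ofReal (pmfN r z.1 n / z.1) * lossE L (z.2 / z.1) :=
    ((measurable_pmfN_div r n).ennreal_ofReal.comp measurable_fst).mul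
      (h2.measurable_lossE.comp (measurable_snd.div measurable_fst))
  calc ENNReal.ofReal (κ / n) * η
      = ∫⁻ _ in Ioi (0 : ℝ), ENNReal.ofReal (κ / n) * η ∂μ := by
        rw [setLIntegral_const, hμ1, mul_one]
    _ ≤ ∫⁻ y in Ioi (0 : ℝ), (∫⁻ p in Ioo ε δ,
          ENNReal.ofReal (pmfN r p n / p) * lossE L (y / p)) ∂μ := by
        refine setLIntegral_mono' measurableSet_Ioi fun y hy => ?_
        exact (mul_le_mul_right (hη _ (mul_pos hn0 hy)) _).trans
          (le_setLIntegral_pmfN_mul_lossE hr h2 ha hδ hκ hn hε hbδ hfac)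
    _ = ∫⁻ p in Ioo ε δ, ∫⁻ y in Ioi (0 : ℝ),
          ENNReal.ofReal (pmfN r p n / p) * lossE L (y / p) ∂μ :=
        (lintegral_lintegral_swap (hm.aemeasurable)).symm
    _ = ∫⁻ p in Ioo ε δ, riskDensity r L μ n p := by
        refine lintegral_congr fun p => ?_
        exact lintegral_const_mul _ (h2.measurable_lossE.comp (measurable_id.div_const p))

theorem log_sub_log_le_sum_inv {r : ℕ} (hr : 1 ≤ r) {m M : ℕ} (hmM : m ≤ M) :
    Real.log (r + M : ℕ) - Real.log (r + m : ℕ) ≤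
      ∑ k ∈ Finset.Ico m M, (((r + k : ℕ) : ℝ))⁻¹ := by
  induction M, hmM using Nat.le_induction with
  | base => simp
  | succ M hM ih =>
    rw [Finset.sum_Ico_succ_top hM]
    have h0 : (0 : ℝ) < ((r + M : ℕ) : ℝ) := by exact_mod_cast (show 0 < r + M by omega)
    have e : ((r + (M + 1) : ℕ) : ℝ) = ((r + M : ℕ) : ℝ) * (1 + ((r + M : ℕ) : ℝ)⁻¹) := by
      field_simp; push_cast; ring
    rw [e, Real.log_mul h0.ne' (by positivity)]
    have := Real.log_le_sub_one_of_pos (show 0 < 1 + ((r + M : ℕ) : ℝ)⁻¹ by positivity)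
    linarith

theorem setLIntegral_Ioo_inv {ε δ : ℝ} (hε : 0 < ε) (hεδ : ε ≤ δ) :
    ∫⁻ p in Ioo ε δ, ENNReal.ofReal p⁻¹ = ENNReal.ofReal (Real.log (δ / ε)) := by
  have hδ : 0 < δ := hε.trans_le hεδ
  have h0 : (0 : ℝ) ∉ uIcc ε δ := by
    rw [uIcc_of_le hεδ]
    exact fun h => absurd h.1 (not_le.2 hε)
  have hi : IntervalIntegrable (fun p : ℝ => p⁻¹) volume ε δ :=
    intervalIntegral.intervalIntegrable_inv (fun p hp => fun h => h0 (h ▸ hp)) continuousOn_id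
  rw [← integral_inv h0, intervalIntegral.integral_of_le hεδ, setLIntegral_congr Ioo_ae_eq_Ioc,
    ofReal_integral_eq_lintegral_ofReal ((intervalIntegrable_iff_integrableOn_Ioc_of_le hεδ).1 hi)]
  filter_upwards [ae_restrict_mem measurableSet_Ioc] with p hp
  exact inv_nonneg.2 (hε.trans hp.1).le

/-- No estimator has asymptotically smaller risk than a strict lower bound of the asymptotic risk.
If the risk were eventually below `η' < η`, then its integral over `p ∈ (ε, δ)` against `dp / p`
would be at most `η' * log (δ / ε)`; but the term `N = n` contributes about `η / n` as long as
`n` is between `b / δ` and `a / ε`, and these terms add up to `η * log (δ / ε) + O(1)`. -/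
theorem le_limsupRisk {r : ℕ} (hr : 1 ≤ r) {L : ℝ → ℝ}
    (hL : ∀ x : ℝ, 0 < x → 0 ≤ L x) (h1 : LocBV L) (h2 : FinDisc L) (h3 : ThetaBounds r L)
    (h4l : LeftCond r L) (h4r : RightCond L) {η : ℝ≥0∞}
    (hη : ∀ Ω : ℝ, 0 < Ω → η < asympRisk r L Ω) (G : Estimator r) : η ≤ limsupRisk r L G := by
  by_contra! hcon
  obtain ⟨a, b, ha, hab, htr⟩ := exists_forall_lt_truncRisk hr hL h1 h2 h3 h4l h4r hη
  have hηtop : η ≠ ⊤ := ((hη 1 one_pos).trans_le le_top).ne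
  lift η to ℝ≥0 using hηtop
  obtain ⟨η', hη1, hη2⟩ := ENNReal.lt_iff_exists_nnreal_btwn.1 hcon
  have hη2' : (η' : ℝ) < η := by exact_mod_cast hη2
  have hη0 : (0 : ℝ) < η := lt_of_le_of_lt η'.coe_nonneg hη2'
  have hb0 : 0 < b := ha.trans_le hab
  -- the risk is below `η'` on `(0, δ)`
  have hev : ∀ᶠ p in 𝓝[>] (0 : ℝ), risk r L G p < η' := eventually_lt_of_limsup_lt hη1
  obtain ⟨δ₀, hδ₀, hδ₀s⟩ := mem_nhdsGT_iff_exists_Ioo_subset.1 hev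
  set δ : ℝ := min δ₀ 1 with hδdef
  have hδ0 : 0 < δ := lt_min hδ₀ one_pos
  have hδ1 : δ ≤ 1 := min_le_right _ _
  have hrisk : ∀ p ∈ Ioo 0 δ, risk r L G p ≤ η' := fun p hp =>
    (show risk r L G p < η' from hδ₀s ⟨hp.1, hp.2.trans_le (min_le_left _ _)⟩).le
  -- the error of the Gamma approximation is absorbed by `κ < 1`
  obtain ⟨κ, hκ1, hκ2⟩ := exists_between ((div_lt_one hη0).2 hη2')
  have hκη : (η' : ℝ) < κ * η := (div_lt_iff₀ hη0).1 hκ1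
  have hκ0 : 0 ≤ κ := (div_nonneg η'.coe_nonneg η.coe_nonneg).trans hκ1.le
  obtain ⟨m, hm⟩ := eventually_atTop.1
    (((tendsto_pmfFactor r b).eventually (lt_mem_nhds hκ2)).and
      ((tendsto_const_div_atTop_nhds_zero_nat b).eventually (gt_mem_nhds hδ0)))
  have hpos : ∀ k : ℕ, (0 : ℝ) < ((r + k : ℕ) : ℝ) := fun k => by
    exact_mod_cast (show 0 < r + k by omega)
  have hmain : ∀ M : ℕ, m ≤ M →
      κ * η * (Real.log (r + M : ℕ) - Real.log (r + m : ℕ)) ≤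
        η' * (Real.log (r + M : ℕ) + Real.log (δ / a)) := by
    intro M hM
    set ε : ℝ := a / (r + M : ℕ) with hε
    have hε0 : 0 < ε := div_pos ha (hpos M)
    have hεδ : ε ≤ δ := by
      refine le_trans ?_ (hm (r + M) (by omega)).2.le
      rw [hε]
      have := hpos M
      gcongr
    have hlower : ∀ k ∈ Finset.Ico m M, ENNReal.ofReal (κ / (r + k : ℕ)) * η ≤
        ∫⁻ p in Ioo ε δ, riskDensity r L (G.law (r + k)) (r + k) p := by
      intro k hk
      obtain ⟨hk1, hk2⟩ := Finset.mem_Ico.1 hk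
      have := G.isProb (r + k) (Nat.le_add_right r k)
      have hmk := hm (r + k) (by omega)
      refine le_setLIntegral_riskDensity hr h2 (G.pos (r + k) (Nat.le_add_right r k)) ha hδ1 hκ0
        (Nat.le_add_right r k) ?_ hmk.2 hmk.1.le (fun Ω hΩ => (htr Ω hΩ).le)
      have h1 := hpos k
      have h2 : ((r + k : ℕ) : ℝ) < ((r + M : ℕ) : ℝ) := by exact_mod_cast (by omega)
      rw [hε]
      gcongr
    have hchain : ENNReal.ofReal (∑ k ∈ Finset.Ico m M, κ / (r + k : ℕ) * η) ≤
        ENNReal.ofReal (η' * Real.log (δ / ε)) := by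
      calc ENNReal.ofReal (∑ k ∈ Finset.Ico m M, κ / (r + k : ℕ) * η)
          = ∑ k ∈ Finset.Ico m M, ENNReal.ofReal (κ / (r + k : ℕ)) * η := by
            rw [ENNReal.ofReal_sum_of_nonneg (fun k _ => by positivity)]
            refine Finset.sum_congr rfl fun k _ => ?_
            rw [ENNReal.ofReal_mul (by positivity), ENNReal.ofReal_coe_nnreal]
        _ ≤ ∑ k ∈ Finset.Ico m M, ∫⁻ p in Ioo ε δ,
              riskDensity r L (G.law (r + k)) (r + k) p := Finset.sum_le_sum hlower
        _ = ∫⁻ p in Ioo ε δ, ∑ k ∈ Finset.Ico m M,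
              riskDensity r L (G.law (r + k)) (r + k) p := by
            refine (lintegral_finsetSum _ fun k _ => ?_).symm
            have := G.isProb (r + k) (Nat.le_add_right r k)
            exact measurable_riskDensity r h2 _ _
        _ ≤ ∫⁻ p in Ioo ε δ, η' * ENNReal.ofReal p⁻¹ := by
            refine setLIntegral_mono' measurableSet_Ioo fun p hp => ?_
            have hp0 : 0 < p := hε0.trans hp.1
            refine (sum_riskDensity_le r L G hp0 _).trans ?_
            rw [mul_comm]
            exact mul_le_mul_left (hrisk p ⟨hp0, hp.2⟩) _
        _ = ENNReal.ofReal (η' * Real.log (δ / ε)) := by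
            rw [lintegral_const_mul _ (by fun_prop), setLIntegral_Ioo_inv hε0 hεδ,
              ENNReal.ofReal_mul η'.coe_nonneg, ENNReal.ofReal_coe_nnreal]
    have hlog0 : 0 ≤ Real.log (δ / ε) := Real.log_nonneg ((one_le_div hε0).2 hεδ)
    have hreal := (ENNReal.ofReal_le_ofReal_iff (mul_nonneg η'.coe_nonneg hlog0)).1 hchain
    have hlog : Real.log (δ / ε) = Real.log (r + M : ℕ) + Real.log (δ / a) := by
      rw [← Real.log_mul (hpos M).ne' (div_pos hδ0 ha).ne', hε]
      congr 1
      field_simp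
    rw [← hlog]
    refine le_trans ?_ hreal
    calc κ * η * (Real.log (r + M : ℕ) - Real.log (r + m : ℕ))
        ≤ κ * η * ∑ k ∈ Finset.Ico m M, (((r + k : ℕ) : ℝ))⁻¹ :=
          mul_le_mul_of_nonneg_left (log_sub_log_le_sum_inv hr hM) (by positivity)
      _ = _ := by
          rw [Finset.mul_sum]
          refine Finset.sum_congr rfl fun k _ => ?_
          rw [div_eq_mul_inv]; ring
  -- the logarithmic terms carry the larger factor on the left
  have htend : Tendsto (fun M : ℕ => (κ * η - η') * Real.log (r + M : ℕ)) atTop atTop := by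
    refine Tendsto.const_mul_atTop (by linarith) (Real.tendsto_log_atTop.comp ?_)
    refine tendsto_natCast_atTop_atTop.comp (tendsto_atTop_mono (fun M => ?_) tendsto_id)
    exact Nat.le_add_left M r
  obtain ⟨M, hM1, hM2⟩ := ((htend.eventually (eventually_gt_atTop
    (κ * η * Real.log (r + m : ℕ) + η' * Real.log (δ / a)))).and (eventually_ge_atTop m)).exists
  have := hmain M hM2
  linarith

end InvBinom

/-- The loss function is the restriction of `L` to `(0, ∞)`; its other values play no role.
The number `ηstar` is the minimum of the asymptotic risk over the class `F_n`. -/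
theorem mainTheorem1 (r : ℕ) (hr : 1 ≤ r) (L : ℝ → ℝ) (hL : ∀ x : ℝ, 0 < x → 0 ≤ L x)
    (h1 : InvBinom.LocBV L) (h2 : InvBinom.FinDisc L) (h3 : InvBinom.ThetaBounds r L)
    (h4l : InvBinom.LeftCond r L) (h4r : InvBinom.RightCond L) :
    ∃ ηstar : ℝ≥0,
      IsLeast {v : ℝ≥0∞ | ∃ (g : ℕ → ℝ) (Ω : ℝ),
        InvBinom.InClassFn r g Ω ∧ v = InvBinom.asympRisk r L Ω} (ηstar : ℝ≥0∞) ∧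
      IsLeast {v : ℝ≥0∞ | ∃ G : InvBinom.Estimator r,
        v = InvBinom.limsupRisk r L G} (ηstar : ℝ≥0∞) := by
  obtain ⟨Ω₀, hΩ₀, hmin⟩ := InvBinom.exists_asympRisk_min hr hL h1 h2 h3 h4l h4r
  have hcoe : (((InvBinom.asympRisk r L Ω₀).toNNReal : ℝ≥0) : ℝ≥0∞) = InvBinom.asympRisk r L Ω₀ :=
    ENNReal.coe_toNNReal (InvBinom.asympRisk_lt_top hr hL h1 h2 h3 hΩ₀).ne
  refine ⟨(InvBinom.asympRisk r L Ω₀).toNNReal, ⟨?_, ?_⟩, ⟨?_, ?_⟩⟩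
  · refine ⟨fun n => Ω₀ / n, Ω₀, ⟨fun n hn => ?_, ?_, hΩ₀.ne'⟩, hcoe⟩
    · exact div_pos hΩ₀ (by exact_mod_cast (show 0 < n by omega))
    · refine tendsto_const_nhds.congr' ?_
      filter_upwards [eventually_gt_atTop 0] with n hn
      have : (n : ℝ) ≠ 0 := by exact_mod_cast hn.ne'
      field_simp
  · rintro v ⟨g, Ω, ⟨hg, hlim, hne⟩, rfl⟩
    rw [hcoe]
    have h0 : 0 ≤ Ω := by
      refine ge_of_tendsto hlim ?_
      filter_upwards [eventually_ge_atTop r] with n hn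
      exact mul_nonneg n.cast_nonneg (hg n hn).le
    exact hmin Ω (lt_of_le_of_ne h0 hne.symm)
  · exact ⟨InvBinom.ratioEstimator hr hΩ₀, hcoe.trans
      (InvBinom.tendsto_risk_ratioEstimator hr hL h1 h2 h3 hΩ₀).limsup_eq.symm⟩
  · rintro v ⟨G, rfl⟩
    rw [hcoe]
    refine le_of_forall_lt_imp_le_of_dense fun η hη => ?_
    exact InvBinom.le_limsupRisk hr hL h1 h2 h3 h4l h4r
      (fun Ω hΩ => hη.trans_le (hmin Ω hΩ)) G
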